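/- Let $d\ge 3$ and let $D\subset\mathbb{R}^d$ be a bounded strongly minimally convex domain, i.e. a nonempty, bounded, connected open set for which there are an open set $U\subset\mathbb R^d$ and a $\mathcal C^2$ function $u:U\to\mathbb{R}$ with $D=\{x\in U:u(x)<0\}$, $\partial D=\{x\in U:u(x)=0\}$, $du\ne0$ on $\partial D$, such that for all $x$ in an open neighbourhood of $\partial D$ the trace of the Hessian of $u$ at $x$ restricted to any $2$-plane $\Lambda\subset\mathbb{R}^d$ is positive. Notation. Let $\delta_D(x)$ be the Euclidean distance of $x$ to $\partial D$. For $\varepsilon\in(0,1)$ let $N=\overline{\{x\in\mathbb R^d:\delta_D(x)<\varepsilon\}}\cap D$. Call $\varepsilon\in(0,1)$ admissible if every $x\in N$ has a unique nearest point $\pi(x)\in\partial D$. For $x\in N$, $v\in\mathbb{R}^d$ write $v=v_N+v_T$ with $v_N=\langle v,n_{\pi(x)}\rangle n_{\pi(x)}$, where $n_\xi$ is the outer unit normal of $\partial D$ at $\xi$. For admissible $\varepsilon$ and $c>0$ put $$F(x,v)=\frac{\|v_N\|}{2\delta_D(x)}+\frac{\|v_T\|}{\delta_D(x)^{1/2}}\quad(x\in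 N),\qquad F(x,v)=c\|v\|\quad(x\in D\setminus N),$$ and $d_F(x,y)=\inf_\gamma\int_0^1F(\gamma(t),\dot\gamma(t))\,dt$ for $x,y\in D$, the infimum being over all piecewise $\mathcal C^1$ curves $\gamma:[0,1]\to D$ from $x$ to $y$. For a metric space $(X,\rho)$ and $x,y,o\in X$ let $(x|y)_o=\frac12(\rho(x,o)+\rho(y,o)-\rho(x,y))$. The space is Gromov hyperbolic if there is $k\ge0$ with $(x|y)_o\ge\min\{(x|z)_o,(y|z)_o\}-k$ for all $x,y,z,o\in X$. In that case fix $o\in X$; the Gromov boundary $\partial_GX$ is the set of sequences $(x_i)$ with $\lim_{i,j\to\infty}(x_i|x_j)_o=+\infty$, modulo the equivalence $(x_i)\sim(y_i)\iff\lim_{i\to\infty}(x_i|y_i)_o=+\infty$. For points $a,b$ of $\overline X^G=X\sqcup\partial_GX$ let $(a|b)_o$ be the supremum of $\liminf_{i,j\to\infty}(x_i|y_j)_o$ over sequences $(x_i),(y_j)$ representing $a$ and $b$ (the constant sequence for a point of $X$, the members of the class for a point of $\partial_GX$). The Gromov compactification is $\overline X^G$ with the topology in which a set $V$ is open iff $V\cap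 X$ is open in $(X,\rho)$ and for each $\xi\in V\cap\partial_GX$ there is $r\in\mathbb R$ with $\{a\in\overline X^G:(a|\xi)_o>r\}\subset V$. Proposition. Admissible $\varepsilon\in(0,1)$ exist, and for each admissible $\varepsilon$ there is $c>0$ such that $F$ is upper semicontinuous on $D\times\mathbb{R}^d$. For every admissible $\varepsilon\in(0,1)$ and every $c>0$ such that $F$ is upper semicontinuous on $D\times\mathbb R^d$, the function $d_F$ is a distance on $D$, the metric space $(D,d_F)$ is Gromov hyperbolic, and, for every base point $o\in D$, the identity map of $D$ extends to a homeomorphism from the Gromov compactification $\overline D^G$ of $(D,d_F)$ onto the Euclidean closure $\overline D$. -/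

import Mathlib

open Set Filter Topology

noncomputable section

namespace MinDom

/-- Euclidean space of dimension `d`. -/
abbrev Euc (d : ℕ) := EuclideanSpace ℝ (Fin d)

/-! ### Strongly minimally convex domains -/

/-- The trace of the restriction to the subspace `Λ` of the Hessian quadratic form of `u` at `x`,
computed in an orthonormal basis of `Λ` (it does not depend on that basis). -/
def traceHessOn {d : ℕ} (u : Euc d → ℝ) (x : Euc d) (Λ : Submodule ℝ (Euc d)) : ℝ :=
  ∑ i, fderiv ℝ (fderiv ℝ u) x (stdOrthonormalBasis ℝ Λ i : Euc d)
    (stdOrthonormalBasis ℝ Λ i : Euc d)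

/-- `u` is strongly minimal plurisubharmonic on `V`: the trace of its Hessian on every
two-dimensional plane is positive at every point of `V`. -/
def StronglyMPSHOn {d : ℕ} (u : Euc d → ℝ) (V : Set (Euc d)) : Prop :=
  ∀ x ∈ V, ∀ Λ : Submodule ℝ (Euc d), Module.finrank ℝ Λ = 2 → 0 < traceHessOn u x Λ

/-- `u`, considered on the open set `U`, is a `C²` defining function of `D`. -/
structure IsC2DefiningFunction {d : ℕ} (D U : Set (Euc d)) (u : Euc d → ℝ) : Prop where
  isOpen : IsOpen U
  contDiffOn : ContDiffOn ℝ 2 u U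
  eq_neg : D = {x ∈ U | u x < 0}
  frontier_eq : frontier D = {x ∈ U | u x = 0}
  fderiv_ne : ∀ x ∈ frontier D, fderiv ℝ u x ≠ 0

/-- Bounded strongly minimally convex domains (a domain is a nonempty connected open set). -/
structure IsStronglyMinimallyConvex {d : ℕ} (D : Set (Euc d)) : Prop where
  isOpen : IsOpen D
  isConnected : IsConnected D
  isBounded : Bornology.IsBounded D
  exists_defining : ∃ (U : Set (Euc d)) (u : Euc d → ℝ), IsC2DefiningFunction D U u ∧
    ∃ V : Set (Euc d), IsOpen V ∧ frontier D ⊆ V ∧ V ⊆ U ∧ StronglyMPSHOn u V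

/-! ### The Finsler metric `F` and its distance -/

/-- The distance `δ_D(x)` to the boundary of `D`. -/
def bdryDist {d : ℕ} (D : Set (Euc d)) (x : Euc d) : ℝ := Metric.infDist x (frontier D)

/-- `ξ` is a point of the boundary of `D` that is nearest to `x`. -/
def IsNearestBdry {d : ℕ} (D : Set (Euc d)) (x ξ : Euc d) : Prop :=
  ξ ∈ frontier D ∧ ‖x - ξ‖ = bdryDist D x

/-- A choice `π(x)` of a nearest boundary point. -/
def proj {d : ℕ} (D : Set (Euc d)) (x : Euc d) : Euc d := Classical.epsilon (IsNearestBdry D x)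

/-- The collar `N`: the points of `D` in the closure of the `ε`-neighbourhood of `∂D`. -/
def collar {d : ℕ} (D : Set (Euc d)) (ε : ℝ) : Set (Euc d) :=
  closure {x | bdryDist D x < ε} ∩ D

/-- The projection to the boundary is single-valued on the collar, so that `F` makes sense. -/
def HasUniqueProj {d : ℕ} (D : Set (Euc d)) (ε : ℝ) : Prop :=
  ∀ x ∈ collar D ε, ∃! ξ, IsNearestBdry D x ξ

/-- `n` is the outer unit normal of `∂D` at `ξ`: the normalized gradient of a local `C¹`
defining function of `D` near `ξ`. -/
def IsOuterUnitNormal {d : ℕ} (D : Set (Euc d)) (ξ n : Euc d) : Prop :=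
  ∃ u : Euc d → ℝ, ContDiffAt ℝ 1 u ξ ∧ u ξ = 0 ∧ gradient u ξ ≠ 0 ∧
    (∀ᶠ x in 𝓝 ξ, x ∈ D ↔ u x < 0) ∧ n = ‖gradient u ξ‖⁻¹ • gradient u ξ

/-- The outer unit normal `n_ξ` (unique wherever it exists). -/
def outerNormal {d : ℕ} (D : Set (Euc d)) (ξ : Euc d) : Euc d :=
  Classical.epsilon (IsOuterUnitNormal D ξ)

/-- The normal component `v_N` of `v` at `π(x)`. -/
def normalPart {d : ℕ} (D : Set (Euc d)) (x v : Euc d) : Euc d :=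
  inner ℝ v (outerNormal D (proj D x)) • outerNormal D (proj D x)

/-- The tangential component `v_T` of `v` at `π(x)`. -/
def tangentPart {d : ℕ} (D : Set (Euc d)) (x v : Euc d) : Euc d := v - normalPart D x v

open Classical in
/-- The Finsler metric `F` with parameters `ε` and `c`. -/
def finslerF {d : ℕ} (D : Set (Euc d)) (ε c : ℝ) (x v : Euc d) : ℝ :=
  if x ∈ collar D ε then
    ‖normalPart D x v‖ / (2 * bdryDist D x) + ‖tangentPart D x v‖ / Real.sqrt (bdryDist D x)
  else c * ‖v‖

/-- `F` is upper semicontinuous on `D × ℝ^d`. -/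
def FinslerUSC {d : ℕ} (D : Set (Euc d)) (ε c : ℝ) : Prop :=
  UpperSemicontinuousOn (fun p : Euc d × Euc d => finslerF D ε c p.1 p.2) (D ×ˢ univ)

/-- `γ` restricted to `[0,1]` is piecewise `C¹`: continuous, and `C¹` up to the end points on each
of the finitely many closed intervals of a subdivision. -/
def IsPiecewiseC1 {d : ℕ} (γ : ℝ → Euc d) : Prop :=
  ContinuousOn γ (Icc 0 1) ∧ ∃ (n : ℕ) (t : ℕ → ℝ), Monotone t ∧ t 0 = 0 ∧ t n = 1 ∧
    ∀ i < n, ContDiffOn ℝ 1 γ (Icc (t i) (t (i + 1)))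

/-- The length of a curve with respect to `F`. -/
def lengthF {d : ℕ} (D : Set (Euc d)) (ε c : ℝ) (γ : ℝ → Euc d) : ℝ :=
  ∫ t in (0 : ℝ)..1, finslerF D ε c (γ t) (deriv γ t)

/-- The distance `d_F` on `D`: the infimum of the lengths of the piecewise `C¹` curves in `D`
that join the two points. -/
def distF {d : ℕ} (D : Set (Euc d)) (ε c : ℝ) (x y : D) : ℝ :=
  sInf {L : ℝ | ∃ γ : ℝ → Euc d, IsPiecewiseC1 γ ∧ (∀ t ∈ Icc (0 : ℝ) 1, γ t ∈ D) ∧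
    γ 0 = x ∧ γ 1 = y ∧ L = lengthF D ε c γ}

/-! ### Gromov hyperbolicity and the Gromov compactification

These notions are stated for a distance function `δ : X → X → ℝ`. -/

/-- `δ` is a distance function on `X`. -/
structure IsMetric {X : Type*} (δ : X → X → ℝ) : Prop where
  nonneg : ∀ x y, 0 ≤ δ x y
  eq_zero_iff : ∀ x y, δ x y = 0 ↔ x = y
  symm : ∀ x y, δ x y = δ y x
  triangle : ∀ x y z, δ x z ≤ δ x y + δ y z

/-- The Gromov product `(x|y)_o`. -/
def gromovProd {X : Type*} (δ : X → X → ℝ) (o x y : X) : ℝ :=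
  (δ x o + δ y o - δ x y) / 2

/-- Gromov hyperbolicity. -/
def IsGromovHyperbolic {X : Type*} (δ : X → X → ℝ) : Prop :=
  ∃ k : ℝ, 0 ≤ k ∧ ∀ x y z o : X,
    min (gromovProd δ o x z) (gromovProd δ o y z) - k ≤ gromovProd δ o x y

/-- The sequence `x` converges at infinity. -/
def ConvergesAtInfinity {X : Type*} (δ : X → X → ℝ) (o : X) (x : ℕ → X) : Prop :=
  Tendsto (fun p : ℕ × ℕ => gromovProd δ o (x p.1) (x p.2)) atTop atTop

/-- The sequences converging at infinity. -/
def SeqAtInfinity {X : Type*} (δ : X → X → ℝ) (o : X) :=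
  {x : ℕ → X // ConvergesAtInfinity δ o x}

/-- Equivalence of two sequences converging at infinity. -/
def SeqEquiv {X : Type*} (δ : X → X → ℝ) (o : X) (x y : SeqAtInfinity δ o) : Prop :=
  Tendsto (fun i : ℕ => gromovProd δ o (x.1 i) (y.1 i)) atTop atTop

/-- The Gromov boundary: equivalence classes of sequences converging at infinity
(`SeqEquiv` is an equivalence relation if `δ` is a Gromov hyperbolic distance). -/
def GromovBoundary {X : Type*} (δ : X → X → ℝ) (o : X) := Quot (SeqEquiv δ o)

/-- The Gromov compactification as a set: the disjoint union of `X` and its Gromov boundary. -/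
inductive GromovCompactification {X : Type*} (δ : X → X → ℝ) (o : X)
  | interior (x : X) : GromovCompactification δ o
  | boundary (ξ : GromovBoundary δ o) : GromovCompactification δ o

/-- The sequences that represent a point of the Gromov compactification: the constant sequence for
a point of `X`, the members of the class for a point of the Gromov boundary. -/
def Represents {X : Type*} {δ : X → X → ℝ} {o : X} (x : ℕ → X) :
    GromovCompactification δ o → Prop
  | .interior p => ∀ i, x i = p
  | .boundary ξ => ∃ h : ConvergesAtInfinity δ o x, Quot.mk (SeqEquiv δ o) ⟨x, h⟩ = ξ

/-- The Gromov product extended to the compactification: the supremum of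
`liminf_{i,j} (x_i|y_j)_o` over the sequences that represent the two points. -/
def extGromovProd {X : Type*} {δ : X → X → ℝ} {o : X} (a b : GromovCompactification δ o) :
    EReal :=
  sSup {L : EReal | ∃ x y : ℕ → X, Represents x a ∧ Represents y b ∧
    L = liminf (fun p : ℕ × ℕ => ((gromovProd δ o (x p.1) (y p.2) : ℝ) : EReal)) atTop}

/-- The topology of the Gromov compactification: the points of `X` have the balls of `δ` as
basic neighbourhoods, a point `ξ` of the boundary has the sets `{a | (a|ξ)_o > r}`. -/
instance {X : Type*} (δ : X → X → ℝ) (o : X) :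
    TopologicalSpace (GromovCompactification δ o) where
  IsOpen V :=
    (∀ x : X, .interior x ∈ V → ∃ r : ℝ, 0 < r ∧ ∀ y : X, δ x y < r → .interior y ∈ V) ∧
    (∀ ξ : GromovBoundary δ o, .boundary ξ ∈ V →
      ∃ r : ℝ, ∀ a : GromovCompactification δ o, (r : EReal) < extGromovProd a (.boundary ξ) →
        a ∈ V)
  isOpen_univ := ⟨fun _ _ => ⟨1, one_pos, fun _ _ => mem_univ _⟩,
    fun _ _ => ⟨0, fun _ _ => mem_univ _⟩⟩
  isOpen_inter := by
    rintro V W ⟨hV, hV'⟩ ⟨hW, hW'⟩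
    refine ⟨fun x hx => ?_, fun ξ hξ => ?_⟩
    · obtain ⟨r, hr, h⟩ := hV x hx.1
      obtain ⟨s, hs, h'⟩ := hW x hx.2
      exact ⟨min r s, lt_min hr hs, fun y hy =>
        ⟨h y (hy.trans_le (min_le_left _ _)), h' y (hy.trans_le (min_le_right _ _))⟩⟩
    · obtain ⟨r, h⟩ := hV' ξ hξ.1
      obtain ⟨s, h'⟩ := hW' ξ hξ.2
      refine ⟨max r s, fun a ha => ⟨h a (lt_of_le_of_lt ?_ ha), h' a (lt_of_le_of_lt ?_ ha)⟩⟩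
      · exact EReal.coe_le_coe_iff.2 (le_max_left _ _)
      · exact EReal.coe_le_coe_iff.2 (le_max_right _ _)
  isOpen_sUnion := by
    intro S hS
    refine ⟨fun x hx => ?_, fun ξ hξ => ?_⟩
    · obtain ⟨V, hVS, hxV⟩ := hx
      obtain ⟨r, hr, h⟩ := (hS V hVS).1 x hxV
      exact ⟨r, hr, fun y hy => ⟨V, hVS, h y hy⟩⟩
    · obtain ⟨V, hVS, hxV⟩ := hξ
      obtain ⟨r, h⟩ := (hS V hVS).2 ξ hxV
      exact ⟨r, fun a ha => ⟨V, hVS, h a ha⟩⟩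

end MinDom

end

/-!
# Gromov hyperbolicity of a domain for a metric with boundary weights

Write `h = √δ_D`. In the collar the normal part of `F` is `|dh| / h` and its tangential part is
the Euclidean length divided by `h`, so `F` looks like the hyperbolic metric of a half-space in
which `h` is the height. The proof makes this precise up to an additive constant: `d_F` differs
from `2 log (‖x - y‖ + max (h x) (h y)) - log (h x) - log (h y)`, which is `modelDist D x y`, by a
bounded quantity. The `C²` regularity of the boundary enters in the form of a Lipschitz field of
outer normals from which the boundary deviates quadratically (`IsNormalField`). No projection
appears in the model, so admissible `ε` need not be small.

*Lower bound* (`exists_le_distF`). For a fixed point `p` and a small constant `a`, the function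
`2 log (a ‖z - p‖ + φ z) - log (φ z)` of `z` grows along every curve at most at the rate `F`. Here
`φ` is a damped version of the truncated height `√(min δ_D ε)`; the damping gains a factor
`1 / (1 + h)` in the normal direction, which pays for the normal component of `d ‖z - p‖`, and the
truncation makes `φ` constant outside the collar. No differentiability of the projection is
needed: the depth along a curve is touched from above by the distance to a fixed boundary point.
The lower bound follows by integration, because the function is Lipschitz along the curve.

*Upper bound* (`exists_distF_le`). Two points are joined by moving both along the normals to depth
comparable to `(‖x - y‖ + max (h x) (h y))²` and by a segment between the two resulting points,
which stays inside an interior tangent ball and is almost tangential, so that its length is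
bounded. If that depth is not small, both points are joined to a fixed compact part of `D`
instead.

*Consequences.* The function `gauge D x y = ‖x - y‖ + max (h x) (h y)` satisfies the triangle
inequality, whence `gauge x y * gauge z o` is at most `4` times the larger of the two products for
the other pairings; taking logarithms gives the four-point condition
(`isGromovHyperbolic_of_model`). The Gromov product of `x` and `y` is `-log (gauge D x y)` up to a
constant, so sequences converge at infinity exactly if they converge to a boundary point, they are
equivalent exactly if the limits agree, and the neighbourhoods of a point at infinity are the
Euclidean ones (`exists_homeomorph`).
-/

namespace MinDom

/-! ### Geometry of the boundary -/

section Boundary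

variable {d : ℕ} {D : Set (Euc d)}

theorem bdryDist_nonneg (x : Euc d) : 0 ≤ bdryDist D x := Metric.infDist_nonneg

theorem abs_bdryDist_sub_le (x y : Euc d) : |bdryDist D x - bdryDist D y| ≤ ‖x - y‖ := by
  have h := (Metric.lipschitz_infDist_pt (frontier D)).dist_le_mul x y
  simpa [bdryDist, Real.dist_eq, dist_eq_norm] using h

theorem continuous_bdryDist : Continuous (bdryDist D) := Metric.continuous_infDist_pt _

theorem bdryDist_le_norm_sub {ξ : Euc d} (hξ : ξ ∈ frontier D) (x : Euc d) :
    bdryDist D x ≤ ‖x - ξ‖ := by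
  simpa [bdryDist, dist_eq_norm] using Metric.infDist_le_dist_of_mem (x := x) hξ

theorem le_bdryDist (hne : (frontier D).Nonempty) {x : Euc d} {r : ℝ}
    (h : ∀ ξ ∈ frontier D, r ≤ ‖x - ξ‖) : r ≤ bdryDist D x :=
  (Metric.le_infDist hne).2 fun {y} hy => by simpa [dist_eq_norm] using h y hy

theorem bdryDist_pos (hD : IsOpen D) (hne : (frontier D).Nonempty) {x : Euc d} (hx : x ∈ D) :
    0 < bdryDist D x := by
  refine (isClosed_frontier.notMem_iff_infDist_pos hne).1 fun h => ?_
  rw [hD.frontier_eq] at h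
  exact h.2 hx

theorem exists_isNearestBdry (hne : (frontier D).Nonempty) (x : Euc d) :
    ∃ ξ, IsNearestBdry D x ξ := by
  obtain ⟨ξ, hξ, h⟩ := isClosed_frontier.exists_infDist_eq_dist hne x
  exact ⟨ξ, hξ, by rw [bdryDist, h, dist_eq_norm]⟩

theorem isNearestBdry_proj (hne : (frontier D).Nonempty) (x : Euc d) :
    IsNearestBdry D x (proj D x) :=
  Classical.epsilon_spec (exists_isNearestBdry hne x)

theorem subset_of_isPreconnected_of_disjoint_frontier (hD : IsOpen D) {s : Set (Euc d)}
    (hs : IsPreconnected s) (hsD : (s ∩ D).Nonempty) (hf : Disjoint s (frontier D)) : s ⊆ D := by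
  refine IsPreconnected.subset_left_of_subset_union hD isClosed_closure.isOpen_compl
    (disjoint_compl_right_iff_subset.2 subset_closure) (fun x hx => ?_) hsD hs
  by_cases hxD : x ∈ D
  · exact Or.inl hxD
  · refine Or.inr fun hxc => disjoint_left.1 hf hx ?_
    rw [hD.frontier_eq]
    exact ⟨hxc, hxD⟩

theorem ball_subset_of_le_bdryDist (hD : IsOpen D) {x : Euc d} (hx : x ∈ D) {r : ℝ}
    (hr : r ≤ bdryDist D x) : Metric.ball x r ⊆ D := by
  rcases le_or_gt r 0 with h | h
  · simp [Metric.ball_eq_empty.2 h]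
  refine subset_of_isPreconnected_of_disjoint_frontier hD (convex_ball x r).isPreconnected
    ⟨x, Metric.mem_ball_self h, hx⟩ (disjoint_left.2 fun y hy hyf => ?_)
  have := bdryDist_le_norm_sub hyf x
  rw [Metric.mem_ball, dist_comm, dist_eq_norm] at hy
  linarith

/-- At a boundary point nearest to an interior point, the outer normal is the direction of the
connecting segment, because the ball around the interior point is tangent to the boundary. -/
theorem IsOuterUnitNormal.eq_of_isNearestBdry (hD : IsOpen D) (hne : (frontier D).Nonempty)
    {x ξ n : Euc d} (hx : x ∈ D) (hξ : IsNearestBdry D x ξ) (hn : IsOuterUnitNormal D ξ n) :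
    ξ - x = bdryDist D x • n := by
  obtain ⟨u, hu, hu0, hg, hloc, rfl⟩ := hn
  set g := gradient u ξ with hgdef
  have hδ := bdryDist_pos hD hne hx
  set δ := bdryDist D x
  have hgn : 0 < ‖g‖ := norm_pos_iff.2 hg
  have hnorm : ‖x - ξ‖ = δ := hξ.2
  -- A direction pointing into the tangent ball is a direction of descent of `u`.
  have key : ∀ w : Euc d, 0 < inner ℝ w (x - ξ) → inner ℝ g w ≤ 0 := by
    intro w hw
    have hd : HasDerivAt (fun t : ℝ => u (ξ + t • w)) (inner ℝ g w) 0 := by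
      have h1 : HasFDerivAt u (fderiv ℝ u ξ) (ξ + (0 : ℝ) • w) := by
        simpa using (hu.differentiableAt one_ne_zero).hasFDerivAt
      have h2 : HasDerivAt (fun t : ℝ => ξ + t • w) w 0 := by
        simpa using ((hasDerivAt_id (0 : ℝ)).smul_const w).const_add ξ
      have h3 := h1.comp_hasDerivAt (0 : ℝ) h2
      rw [hgdef, inner_gradient_left]
      exact h3
    have hs := (hasDerivAt_iff_tendsto_slope_zero.1 hd).mono_left
      (nhdsWithin_mono (0 : ℝ) (fun t (ht : t ∈ Ioi 0) => ne_of_gt ht))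
    have hcont : Tendsto (fun t : ℝ => ξ + t • w) (𝓝 0) (𝓝 ξ) := by
      have : Continuous fun t : ℝ => ξ + t • w := by fun_prop
      simpa using this.tendsto 0
    have hball : ∀ᶠ t : ℝ in 𝓝[>] 0, ξ + t • w ∈ D := by
      have hlt : ∀ᶠ t : ℝ in 𝓝 0, t * ‖w‖ ^ 2 < 2 * inner ℝ w (x - ξ) := by
        have : Tendsto (fun t : ℝ => t * ‖w‖ ^ 2) (𝓝 0) (𝓝 0) := by
          have : Continuous fun t : ℝ => t * ‖w‖ ^ 2 := by fun_prop
          simpa using this.tendsto 0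
        exact this.eventually (gt_mem_nhds (by linarith))
      filter_upwards [nhdsWithin_le_nhds hlt, self_mem_nhdsWithin] with t ht ht0
      have ht0 : 0 < t := ht0
      refine ball_subset_of_le_bdryDist hD hx le_rfl ?_
      rw [Metric.mem_ball, dist_eq_norm]
      refine lt_of_pow_lt_pow_left₀ 2 hδ.le ?_
      have : ‖ξ + t • w - x‖ ^ 2 = t ^ 2 * ‖w‖ ^ 2 - 2 * t * inner ℝ w (x - ξ) + δ ^ 2 := by
        have e : ξ + t • w - x = t • w - (x - ξ) := by abel
        rw [e, norm_sub_sq_real, norm_smul, inner_smul_left, hnorm]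
        simp [mul_pow]; ring
      rw [this]
      nlinarith
    refine le_of_tendsto hs ?_
    filter_upwards [hball, nhdsWithin_le_nhds (hcont.eventually hloc), self_mem_nhdsWithin]
      with t h1 h2 h3
    have h4 := h2.1 h1
    have h3 : 0 < t := h3
    simp only [zero_add, zero_smul, add_zero, hu0, sub_zero, smul_eq_mul]
    exact mul_nonpos_of_nonneg_of_nonpos (inv_nonneg.2 h3.le) h4.le
  set n := ‖g‖⁻¹ • g with hn
  set p := δ⁻¹ • (x - ξ) with hp
  have hn1 : ‖n‖ = 1 := by rw [hn, norm_smul]; simp [hgn.ne']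
  have hp1 : ‖p‖ = 1 := by rw [hp, norm_smul, hnorm]; simp [abs_of_pos hδ, hδ.ne']
  have hxp : x - ξ = δ • p := by rw [hp, smul_smul, mul_inv_cancel₀ hδ.ne', one_smul]
  have hgn' : g = ‖g‖ • n := by rw [hn, smul_smul, mul_inv_cancel₀ hgn.ne', one_smul]
  -- Otherwise `n + p` would be a direction into the ball along which `u` increases.
  have hzero : n + p = 0 := by
    by_contra hne0
    have hpos : 0 < 1 + inner ℝ n p := by
      have h1 : 0 < ‖n + p‖ ^ 2 := by have := norm_pos_iff.2 hne0; positivity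
      rw [norm_add_sq_real, hn1, hp1] at h1
      linarith
    have h1 : 0 < inner ℝ (n + p) (x - ξ) := by
      rw [hxp, inner_smul_right, inner_add_left, real_inner_self_eq_norm_sq, hp1]
      nlinarith
    have h2 := key _ h1
    rw [hgn', inner_smul_left, inner_add_right, real_inner_self_eq_norm_sq, hn1] at h2
    simp only [conj_trivial] at h2
    nlinarith
  have : n = -p := eq_neg_of_add_eq_zero_left hzero
  rw [this, smul_neg, ← hxp, neg_sub]

/-- A unit normal field `ν` on the boundary of `D`, with a constant `K` that controls its
Lipschitz constant and the quadratic deviation of the boundary from its tangent planes. -/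
structure IsNormalField (D : Set (Euc d)) (ν : Euc d → Euc d) (K : ℝ) : Prop where
  norm_eq : ∀ ξ ∈ frontier D, ‖ν ξ‖ = 1
  outer : ∀ ξ ∈ frontier D, IsOuterUnitNormal D ξ (ν ξ)
  inner_le : ∀ ξ ∈ frontier D, ∀ η ∈ frontier D, |inner ℝ (ν ξ) (η - ξ)| ≤ K * ‖η - ξ‖ ^ 2
  lip : ∀ ξ ∈ frontier D, ∀ η ∈ frontier D, ‖ν η - ν ξ‖ ≤ K * ‖η - ξ‖

theorem IsStronglyMinimallyConvex.frontier_nonempty (hd : 0 < d)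
    (hD : IsStronglyMinimallyConvex D) : (frontier D).Nonempty := by
  refine nonempty_frontier_iff.2 ⟨hD.isConnected.nonempty, fun h => ?_⟩
  have : Nonempty (Fin d) := ⟨⟨0, hd⟩⟩
  have hb := hD.isBounded
  rw [h] at hb
  exact NormedSpace.unbounded_univ ℝ (Euc d) hb

theorem IsStronglyMinimallyConvex.isCompact_frontier (hD : IsStronglyMinimallyConvex D) :
    IsCompact (frontier D) :=
  Metric.isCompact_of_isClosed_isBounded isClosed_frontier
    (hD.isBounded.closure.subset frontier_subset_closure)

/-- The bounds required by `IsNormalField` hold locally for the normalized gradient of a `C²`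
function. -/
theorem exists_normalized_gradient_bound {u : Euc d → ℝ} {ξ₀ : Euc d} (hu : ContDiffAt ℝ 2 u ξ₀)
    (hg : gradient u ξ₀ ≠ 0) :
    ∃ t ∈ 𝓝 ξ₀, ∃ C : ℝ, ∀ ξ ∈ t, ∀ η ∈ t, u ξ = 0 → u η = 0 →
      |inner ℝ (‖gradient u ξ‖⁻¹ • gradient u ξ) (η - ξ)| ≤ C * ‖η - ξ‖ ^ 2 ∧
      ‖‖gradient u η‖⁻¹ • gradient u η - ‖gradient u ξ‖⁻¹ • gradient u ξ‖ ≤ C * ‖η - ξ‖ := by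
  have hfd : ContDiffAt ℝ 1 (fderiv ℝ u) ξ₀ := hu.fderiv_right (by norm_num [one_add_one_eq_two])
  have hgd : ContDiffAt ℝ 1 (gradient u) ξ₀ :=
    (InnerProductSpace.toDual ℝ (Euc d)).symm.contDiff.contDiffAt.comp ξ₀ hfd
  have hinv : ContDiffAt ℝ 1 (fun x => ‖gradient u x‖⁻¹) ξ₀ :=
    (hgd.norm ℝ hg).inv (norm_ne_zero_iff.2 hg)
  obtain ⟨K₁, t₁, ht₁, hK₁⟩ := (hinv.smul hgd).exists_lipschitzOnWith
  obtain ⟨K₂, t₂, ht₂, hK₂⟩ := hfd.exists_lipschitzOnWith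
  have hdiff : ∀ᶠ x in 𝓝 ξ₀, DifferentiableAt ℝ u x := by
    filter_upwards [hu.eventually (by simp)] with x hx
    exact hx.differentiableAt two_ne_zero
  have hM : ∀ᶠ x in 𝓝 ξ₀, ‖gradient u x‖⁻¹ < ‖gradient u ξ₀‖⁻¹ + 1 :=
    hinv.continuousAt.eventually (gt_mem_nhds (lt_add_one _))
  obtain ⟨r, hr, hball⟩ := Metric.mem_nhds_iff.1
    (inter_mem (inter_mem ht₁ ht₂) (inter_mem hdiff hM))
  set M := ‖gradient u ξ₀‖⁻¹ + 1
  have hM0 : 0 < M := by positivity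
  refine ⟨Metric.ball ξ₀ r, Metric.ball_mem_nhds _ hr, max K₁ (M * K₂), ?_⟩
  intro ξ hξ η hη hξ0 hη0
  constructor
  · have hseg : segment ℝ ξ η ⊆ Metric.ball ξ₀ r := (convex_ball _ _).segment_subset hξ hη
    have h1 := Convex.norm_image_sub_le_of_norm_fderiv_le' (f := u) (s := segment ℝ ξ η)
      (φ := fderiv ℝ u ξ) (C := K₂ * ‖η - ξ‖) (x := ξ) (y := η)
      (fun z hz => (hball (hseg hz)).2.1) ?_ (convex_segment _ _) (left_mem_segment _ _ _)
      (right_mem_segment _ _ _)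
    · rw [hξ0, hη0, sub_zero, zero_sub, norm_neg, ← inner_gradient_left, Real.norm_eq_abs] at h1
      rw [inner_smul_left, abs_mul]
      simp only [conj_trivial, abs_inv, abs_norm]
      have h2 : ‖gradient u ξ‖⁻¹ ≤ M := (hball hξ).2.2.le
      calc ‖gradient u ξ‖⁻¹ * |inner ℝ (gradient u ξ) (η - ξ)|
          ≤ M * (K₂ * ‖η - ξ‖ * ‖η - ξ‖) := by gcongr
        _ = (M * K₂) * ‖η - ξ‖ ^ 2 := by ring
        _ ≤ _ := by gcongr; exact le_max_right _ _
    · intro z hz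
      have h2 := hK₂.dist_le_mul z (hball (hseg hz)).1.2 ξ (hball hξ).1.2
      rw [dist_eq_norm, dist_eq_norm] at h2
      refine h2.trans ?_
      gcongr
      rw [norm_sub_rev z, norm_sub_rev η]
      obtain ⟨a, b, ha, hb, hab, rfl⟩ := hz
      have : ξ - (a • ξ + b • η) = b • (ξ - η) := by
        have : a = 1 - b := by linarith
        subst this; module
      rw [this, norm_smul, Real.norm_of_nonneg hb]
      exact mul_le_of_le_one_left (norm_nonneg _) (by linarith)
  · have h2 := hK₁.dist_le_mul η (hball hη).1.1 ξ (hball hξ).1.1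
    rw [dist_eq_norm, dist_eq_norm] at h2
    refine h2.trans ?_
    gcongr
    exact le_max_left _ _

/-- The normalized gradients of the defining function form a normal field; the local bounds combine
to global ones because the boundary is compact. -/
theorem IsStronglyMinimallyConvex.exists_isNormalField (hD : IsStronglyMinimallyConvex D) :
    ∃ ν K, 1 ≤ K ∧ IsNormalField D ν K := by
  obtain ⟨U, u, hu, -⟩ := hD.exists_defining
  have hU : ∀ ξ ∈ frontier D, ξ ∈ U ∧ u ξ = 0 := fun ξ hξ => by
    rw [hu.frontier_eq] at hξ; exact hξ
  have hC : ∀ ξ ∈ frontier D, ContDiffAt ℝ 2 u ξ := fun ξ hξ =>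
    hu.contDiffOn.contDiffAt (hu.isOpen.mem_nhds (hU ξ hξ).1)
  have hg : ∀ ξ ∈ frontier D, gradient u ξ ≠ 0 := fun ξ hξ h => hu.fderiv_ne ξ hξ (by
    rw [← toDual_gradient, h, map_zero])
  set ν : Euc d → Euc d := fun ξ => ‖gradient u ξ‖⁻¹ • gradient u ξ with hν
  have hν1 : ∀ ξ ∈ frontier D, ‖ν ξ‖ = 1 := fun ξ hξ => by
    have := norm_ne_zero_iff.2 (hg ξ hξ)
    rw [hν, norm_smul]; simp [this]
  have hS : IsCompact (frontier D ×ˢ frontier D) := hD.isCompact_frontier.prod hD.isCompact_frontier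
  -- Off the diagonal both bounds hold with a constant that depends on the distance to it.
  have main : ∃ C : ℝ, ∀ q ∈ frontier D ×ˢ frontier D, q ∈ frontier D ×ˢ frontier D →
      |inner ℝ (ν q.1) (q.2 - q.1)| ≤ C * ‖q.2 - q.1‖ ^ 2 ∧
      ‖ν q.2 - ν q.1‖ ≤ C * ‖q.2 - q.1‖ := by
    refine hS.induction_on (p := fun S => ∃ C : ℝ, ∀ q ∈ S, q ∈ frontier D ×ˢ frontier D →
      |inner ℝ (ν q.1) (q.2 - q.1)| ≤ C * ‖q.2 - q.1‖ ^ 2 ∧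
      ‖ν q.2 - ν q.1‖ ≤ C * ‖q.2 - q.1‖) ⟨0, by simp⟩
      (fun s t hst ⟨C, h⟩ => ⟨C, fun q hq => h q (hst hq)⟩) ?_ ?_
    · rintro s t ⟨C, h⟩ ⟨C', h'⟩
      refine ⟨max C C', fun q hq hqf => ?_⟩
      rcases hq with hq | hq
      · obtain ⟨h1, h2⟩ := h q hq hqf
        exact ⟨h1.trans (by gcongr; exact le_max_left _ _),
          h2.trans (by gcongr; exact le_max_left _ _)⟩
      · obtain ⟨h1, h2⟩ := h' q hq hqf
        exact ⟨h1.trans (by gcongr; exact le_max_right _ _),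
          h2.trans (by gcongr; exact le_max_right _ _)⟩
    · rintro ⟨ξ₀, η₀⟩ ⟨hξ₀, hη₀⟩
      by_cases hne : ξ₀ = η₀
      · subst hne
        obtain ⟨t, ht, C, h⟩ := exists_normalized_gradient_bound (hC ξ₀ hξ₀) (hg ξ₀ hξ₀)
        exact ⟨t ×ˢ t, nhdsWithin_le_nhds (prod_mem_nhds ht ht), C, fun q hq hqf =>
          h q.1 hq.1 q.2 hq.2 (hU _ hqf.1).2 (hU _ hqf.2).2⟩
      · have hr : 0 < ‖η₀ - ξ₀‖ := norm_pos_iff.2 (sub_ne_zero.2 (Ne.symm hne))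
        set r := ‖η₀ - ξ₀‖ / 2 with hrdef
        have hr2 : 0 < r := by positivity
        have hev : ∀ᶠ q : Euc d × Euc d in 𝓝 (ξ₀, η₀), r < ‖q.2 - q.1‖ := by
          have : Continuous fun q : Euc d × Euc d => ‖q.2 - q.1‖ := by fun_prop
          exact this.continuousAt.eventually (lt_mem_nhds (show r < ‖η₀ - ξ₀‖ by linarith))
        refine ⟨_, nhdsWithin_le_nhds hev, 2 / r, fun q hq hqf => ?_⟩
        have hq : r < ‖q.2 - q.1‖ := hq
        have h1 : 1 ≤ ‖q.2 - q.1‖ / r := (one_le_div hr2).2 hq.le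
        constructor
        · calc |inner ℝ (ν q.1) (q.2 - q.1)| ≤ ‖ν q.1‖ * ‖q.2 - q.1‖ := abs_real_inner_le_norm _ _
            _ = 1 * ‖q.2 - q.1‖ := by rw [hν1 _ hqf.1]
            _ ≤ (2 * (‖q.2 - q.1‖ / r)) * ‖q.2 - q.1‖ := by gcongr; linarith
            _ = _ := by ring
        · calc ‖ν q.2 - ν q.1‖ ≤ ‖ν q.2‖ + ‖ν q.1‖ := norm_sub_le _ _
            _ = 2 * 1 := by rw [hν1 _ hqf.1, hν1 _ hqf.2]; norm_num
            _ ≤ 2 * (‖q.2 - q.1‖ / r) := by gcongr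
            _ = _ := by ring
  obtain ⟨C, hmain⟩ := main
  refine ⟨ν, max C 1, le_max_right _ _, hν1, fun ξ hξ => ?_, fun ξ hξ η hη => ?_,
    fun ξ hξ η hη => ?_⟩
  · refine ⟨u, (hC ξ hξ).of_le (by norm_num), (hU ξ hξ).2, hg ξ hξ, ?_, rfl⟩
    filter_upwards [hu.isOpen.mem_nhds (hU ξ hξ).1] with x hx
    rw [hu.eq_neg]
    exact ⟨fun h => h.2, fun h => ⟨hx, h⟩⟩
  · exact (hmain (ξ, η) ⟨hξ, hη⟩ ⟨hξ, hη⟩).1.trans (by gcongr; exact le_max_left _ _)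
  · exact (hmain (ξ, η) ⟨hξ, hη⟩ ⟨hξ, hη⟩).2.trans (by gcongr; exact le_max_left _ _)

end Boundary

/-! ### Nearest points and the Finsler metric -/

section Finsler

variable {d : ℕ} {D : Set (Euc d)} {ν : Euc d → Euc d} {K : ℝ}

theorem IsNormalField.sub_eq_of_isNearestBdry (hν : IsNormalField D ν K) (hD : IsOpen D)
    {x ξ : Euc d} (hx : x ∈ D) (hξ : IsNearestBdry D x ξ) : ξ - x = bdryDist D x • ν ξ :=
  (hν.outer ξ hξ.1).eq_of_isNearestBdry hD ⟨ξ, hξ.1⟩ hx hξ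

theorem IsNormalField.outerNormal_eq (hν : IsNormalField D ν K) (hD : IsOpen D)
    {x ξ : Euc d} (hx : x ∈ D) (hξ : IsNearestBdry D x ξ) : outerNormal D ξ = ν ξ := by
  have h : IsOuterUnitNormal D ξ (outerNormal D ξ) := Classical.epsilon_spec ⟨_, hν.outer ξ hξ.1⟩
  have hne : (frontier D).Nonempty := ⟨ξ, hξ.1⟩
  have h1 := h.eq_of_isNearestBdry hD hne hx hξ
  rw [hν.sub_eq_of_isNearestBdry hD hx hξ] at h1
  exact (smul_right_injective _ (bdryDist_pos hD hne hx).ne' h1).symm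

theorem IsNormalField.norm_outerNormal (hν : IsNormalField D ν K) (hD : IsOpen D)
    (hne : (frontier D).Nonempty) {x : Euc d} (hx : x ∈ D) : ‖outerNormal D (proj D x)‖ = 1 := by
  rw [hν.outerNormal_eq hD hx (isNearestBdry_proj hne x)]
  exact hν.norm_eq _ (isNearestBdry_proj hne x).1

theorem IsNormalField.outerNormal_proj (hν : IsNormalField D ν K) (hD : IsOpen D)
    (hne : (frontier D).Nonempty) {x : Euc d} (hx : x ∈ D) :
    outerNormal D (proj D x) = (bdryDist D x)⁻¹ • (proj D x - x) := by
  have h := isNearestBdry_proj hne x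
  rw [hν.outerNormal_eq hD hx h, hν.sub_eq_of_isNearestBdry hD hx h, smul_smul,
    inv_mul_cancel₀ (bdryDist_pos hD hne hx).ne', one_smul]

/-- The points at depth `s` below `ξ` stay away from the boundary. -/
theorem IsNormalField.sq_le_norm_sub (hν : IsNormalField D ν K) {ξ ζ : Euc d}
    (hξ : ξ ∈ frontier D) (hζ : ζ ∈ frontier D) {s : ℝ} (hs : 0 ≤ s) :
    s ^ 2 + (1 - 2 * s * K) * ‖ζ - ξ‖ ^ 2 ≤ ‖ξ - s • ν ξ - ζ‖ ^ 2 := by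
  have e : ξ - s • ν ξ - ζ = -((ζ - ξ) + s • ν ξ) := by abel
  rw [e, norm_neg, norm_add_sq_real, norm_smul, hν.norm_eq ξ hξ, inner_smul_right,
    real_inner_comm, Real.norm_of_nonneg hs]
  have h := (abs_le.1 (hν.inner_le ξ hξ ζ hζ)).1
  nlinarith [mul_le_mul_of_nonneg_left h hs]

/-- Closer to the boundary than the radius `1 / (2 K)` of the interior tangent balls the nearest
boundary point is unique. -/
theorem IsNormalField.isNearestBdry_unique (hν : IsNormalField D ν K) (hD : IsOpen D)
    {x ξ η : Euc d} (hx : x ∈ D) (hxK : 2 * bdryDist D x * K < 1)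
    (hξ : IsNearestBdry D x ξ) (hη : IsNearestBdry D x η) : η = ξ := by
  have h1 := hν.sub_eq_of_isNearestBdry hD hx hξ
  have h2 := hν.sq_le_norm_sub hξ.1 hη.1 (bdryDist_nonneg (D := D) x)
  have e : ξ - bdryDist D x • ν ξ = x := by rw [← h1]; abel
  rw [e, hη.2] at h2
  have h3 : ‖η - ξ‖ ^ 2 ≤ 0 := by
    by_contra h
    nlinarith
  have h4 : ‖η - ξ‖ = 0 := by
    have := norm_nonneg (η - ξ)
    exact pow_eq_zero_iff (two_ne_zero) |>.1 (le_antisymm h3 (by positivity))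
  exact sub_eq_zero.1 (norm_eq_zero.1 h4)

theorem bdryDist_le_of_mem_collar {ε : ℝ} {x : Euc d} (hx : x ∈ collar D ε) :
    bdryDist D x ≤ ε :=
  closure_minimal (fun _ hy => le_of_lt hy) (isClosed_le continuous_bdryDist continuous_const) hx.1

theorem mem_collar_of_bdryDist_lt {ε : ℝ} {x : Euc d} (hx : x ∈ D) (h : bdryDist D x < ε) :
    x ∈ collar D ε :=
  ⟨subset_closure h, hx⟩

theorem IsNormalField.hasUniqueProj (hν : IsNormalField D ν K) (hD : IsOpen D)
    (hne : (frontier D).Nonempty) (hK : 0 < K) {ε : ℝ} (hε : 2 * ε * K < 1) :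
    HasUniqueProj D ε := by
  intro x hx
  have h := bdryDist_le_of_mem_collar hx
  refine ⟨proj D x, isNearestBdry_proj hne x, fun η hη => ?_⟩
  exact hν.isNearestBdry_unique hD hx.2 (by nlinarith) (isNearestBdry_proj hne x) hη

theorem norm_normalPart (x v : Euc d) (h : ‖outerNormal D (proj D x)‖ = 1) :
    ‖normalPart D x v‖ = |inner ℝ v (outerNormal D (proj D x))| := by
  rw [normalPart, norm_smul, h, mul_one, Real.norm_eq_abs]

theorem norm_normalPart_le (x v : Euc d) (h : ‖outerNormal D (proj D x)‖ = 1) :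
    ‖normalPart D x v‖ ≤ ‖v‖ := by
  rw [norm_normalPart x v h]
  simpa [h] using abs_real_inner_le_norm v (outerNormal D (proj D x))

theorem norm_tangentPart_le (x v : Euc d) (h : ‖outerNormal D (proj D x)‖ = 1) :
    ‖tangentPart D x v‖ ≤ ‖v‖ := by
  refine le_of_sq_le_sq ?_ (norm_nonneg _)
  rw [tangentPart, normalPart, norm_sub_sq_real, norm_smul, h, inner_smul_right, Real.norm_eq_abs,
    mul_one, sq_abs]
  nlinarith [sq_nonneg (inner ℝ v (outerNormal D (proj D x)))]

theorem norm_le_add_parts (x v : Euc d) :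
    ‖v‖ ≤ ‖normalPart D x v‖ + ‖tangentPart D x v‖ := by
  have : v = normalPart D x v + tangentPart D x v := by simp [tangentPart]
  calc ‖v‖ = ‖normalPart D x v + tangentPart D x v‖ := by rw [← this]
    _ ≤ _ := norm_add_le _ _

variable {ε c : ℝ}

theorem finslerF_of_mem {x : Euc d} (hx : x ∈ collar D ε) (v : Euc d) :
    finslerF D ε c x v = ‖normalPart D x v‖ / (2 * bdryDist D x) +
      ‖tangentPart D x v‖ / Real.sqrt (bdryDist D x) := if_pos hx

theorem finslerF_of_notMem {x : Euc d} (hx : x ∉ collar D ε) (v : Euc d) :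
    finslerF D ε c x v = c * ‖v‖ := if_neg hx

theorem finslerF_nonneg (hc : 0 ≤ c) (x v : Euc d) : 0 ≤ finslerF D ε c x v := by
  by_cases hx : x ∈ collar D ε
  · rw [finslerF_of_mem hx]
    have := bdryDist_nonneg (D := D) x
    positivity
  · rw [finslerF_of_notMem hx]; positivity

theorem finslerF_smul (x v : Euc d) (a : ℝ) :
    finslerF D ε c x (a • v) = |a| * finslerF D ε c x v := by
  have h1 : normalPart D x (a • v) = a • normalPart D x v := by
    simp [normalPart, inner_smul_left, smul_smul]
  have h2 : tangentPart D x (a • v) = a • tangentPart D x v := by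
    rw [tangentPart, h1, tangentPart, smul_sub]
  by_cases hx : x ∈ collar D ε
  · rw [finslerF_of_mem hx, finslerF_of_mem hx, h1, h2, norm_smul, norm_smul, Real.norm_eq_abs]
    ring
  · rw [finslerF_of_notMem hx, finslerF_of_notMem hx, norm_smul, Real.norm_eq_abs]
    ring

theorem half_norm_le_of_bdryDist_le_one (hD : IsOpen D) (hne : (frontier D).Nonempty) {x : Euc d}
    (hx : x ∈ D) (h1 : bdryDist D x ≤ 1) (v : Euc d) :
    1 / 2 * ‖v‖ ≤ ‖normalPart D x v‖ / (2 * bdryDist D x) +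
      ‖tangentPart D x v‖ / Real.sqrt (bdryDist D x) := by
  have h0 := bdryDist_pos hD hne hx
  have hs : 0 < Real.sqrt (bdryDist D x) := Real.sqrt_pos.2 h0
  have hs1 : Real.sqrt (bdryDist D x) ≤ 1 := Real.sqrt_le_one.2 h1
  have e1 : ‖normalPart D x v‖ / 2 ≤ ‖normalPart D x v‖ / (2 * bdryDist D x) :=
    div_le_div_of_nonneg_left (norm_nonneg _) (by positivity) (by linarith)
  have e2 : ‖tangentPart D x v‖ / 2 ≤ ‖tangentPart D x v‖ / Real.sqrt (bdryDist D x) :=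
    div_le_div_of_nonneg_left (norm_nonneg _) (by positivity) (by linarith)
  linarith [norm_le_add_parts (D := D) x v]

theorem le_finslerF (hD : IsOpen D) (hne : (frontier D).Nonempty) (hε : ε ≤ 1) {x : Euc d}
    (hx : x ∈ D) (v : Euc d) : min c (1 / 2) * ‖v‖ ≤ finslerF D ε c x v := by
  by_cases hxc : x ∈ collar D ε
  · rw [finslerF_of_mem hxc]
    refine le_trans ?_ (half_norm_le_of_bdryDist_le_one hD hne hx
      ((bdryDist_le_of_mem_collar hxc).trans hε) v)
    gcongr
    exact min_le_right _ _
  · rw [finslerF_of_notMem hxc]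
    gcongr
    exact min_le_left _ _

theorem IsNormalField.finslerF_le (hν : IsNormalField D ν K) (hD : IsOpen D)
    (hne : (frontier D).Nonempty) (hc : 0 ≤ c) {x : Euc d} (hx : x ∈ D) (v : Euc d) {r : ℝ}
    (hr : 0 < r) (hrx : r ≤ bdryDist D x) :
    finslerF D ε c x v ≤ (1 / (2 * r) + 1 / Real.sqrt r + c) * ‖v‖ := by
  have hn := hν.norm_outerNormal hD hne hx
  have hs : 0 < Real.sqrt r := Real.sqrt_pos.2 hr
  by_cases hxc : x ∈ collar D ε
  · rw [finslerF_of_mem hxc]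
    have e1 : ‖normalPart D x v‖ / (2 * bdryDist D x) ≤ ‖v‖ / (2 * r) :=
      div_le_div₀ (norm_nonneg _) (norm_normalPart_le x v hn) (by positivity) (by linarith)
    have e2 : ‖tangentPart D x v‖ / Real.sqrt (bdryDist D x) ≤ ‖v‖ / Real.sqrt r :=
      div_le_div₀ (norm_nonneg _) (norm_tangentPart_le x v hn) (by positivity)
        (Real.sqrt_le_sqrt hrx)
    have e3 : (1 / (2 * r) + 1 / Real.sqrt r + c) * ‖v‖ =
        ‖v‖ / (2 * r) + ‖v‖ / Real.sqrt r + c * ‖v‖ := by ring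
    have := mul_nonneg hc (norm_nonneg v)
    linarith
  · rw [finslerF_of_notMem hxc]
    gcongr
    have : 0 ≤ 1 / (2 * r) + 1 / Real.sqrt r := by positivity
    linarith

/-- A limit of nearest points is a nearest point, so uniqueness and compactness of the boundary
give continuity. -/
theorem HasUniqueProj.continuousOn_proj (hcpt : IsCompact (frontier D))
    (hne : (frontier D).Nonempty) (h : HasUniqueProj D ε) :
    ContinuousOn (proj D) (collar D ε) := by
  intro x hx
  refine hcpt.tendsto_nhds_of_unique_mapClusterPt
    (Eventually.of_forall fun y => (isNearestBdry_proj hne y).1) fun ξ hξ hcl => ?_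
  refine (h x hx).unique ⟨hξ, ?_⟩ (isNearestBdry_proj hne x)
  have h1 : Tendsto (fun y => ‖x - proj D y‖) (𝓝[collar D ε] x) (𝓝 (bdryDist D x)) := by
    refine tendsto_nhdsWithin_of_tendsto_nhds ?_
    rw [tendsto_iff_norm_sub_tendsto_zero]
    refine squeeze_zero (g := fun y => 2 * ‖y - x‖) (fun _ => norm_nonneg _) (fun y => ?_) ?_
    · have h2 := abs_norm_sub_norm_le (x - proj D y) (y - proj D y)
      have h3 := abs_bdryDist_sub_le (D := D) x y
      rw [(isNearestBdry_proj hne y).2] at h2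
      have e : x - proj D y - (y - proj D y) = x - y := by abel
      rw [e, norm_sub_rev x y] at h2
      rw [norm_sub_rev x y] at h3
      rw [Real.norm_eq_abs]
      rw [abs_le] at *
      constructor <;> linarith
    · have : Continuous fun y : Euc d => 2 * ‖y - x‖ := by fun_prop
      simpa using this.tendsto x
  have hcont : ContinuousAt (fun z : Euc d => ‖x - z‖) ξ := by fun_prop
  have h2 := hcl.continuousAt_comp hcont
  by_contra hne'
  exact hne' (eq_of_nhds_neBot (h2.clusterPt.mono h1).neBot)

/-- The formula on the collar, a relatively closed set, is continuous, and it is at least `‖v‖ / 2`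
there, so `F` can only jump upwards at the collar if `c = 1 / 2`. -/
theorem IsNormalField.finslerUSC_half (hν : IsNormalField D ν K) (hD : IsOpen D)
    (hne : (frontier D).Nonempty) (hcpt : IsCompact (frontier D)) (hε1 : ε ≤ 1)
    (h : HasUniqueProj D ε) : FinslerUSC D ε (1 / 2) := by
  set N := collar D ε with hN
  have hproj := h.continuousOn_proj hcpt hne
  have hND : ∀ p ∈ N ×ˢ (univ : Set (Euc d)), p.1 ∈ D := fun p hp => hp.1.2
  have hfst : ContinuousOn (fun p : Euc d × Euc d => proj D p.1) (N ×ˢ univ) :=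
    hproj.comp continuousOn_fst fun p hp => hp.1
  have hb : ContinuousOn (fun p : Euc d × Euc d => bdryDist D p.1) (N ×ˢ univ) :=
    (continuous_bdryDist.comp continuous_fst).continuousOn
  have hb0 : ∀ p ∈ N ×ˢ (univ : Set (Euc d)), bdryDist D p.1 ≠ 0 := fun p hp =>
    (bdryDist_pos hD hne (hND p hp)).ne'
  have hn : ContinuousOn (fun p : Euc d × Euc d => outerNormal D (proj D p.1)) (N ×ˢ univ) := by
    refine ((hb.inv₀ hb0).smul (hfst.sub continuousOn_fst)).congr fun p hp => ?_
    exact hν.outerNormal_proj hD hne (hND p hp)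
  have hnp : ContinuousOn (fun p : Euc d × Euc d => normalPart D p.1 p.2) (N ×ˢ univ) :=
    (continuousOn_snd.inner hn (𝕜 := ℝ)).smul hn
  have htp : ContinuousOn (fun p : Euc d × Euc d => tangentPart D p.1 p.2) (N ×ˢ univ) :=
    continuousOn_snd.sub hnp
  have hG : ContinuousOn (fun p : Euc d × Euc d => ‖normalPart D p.1 p.2‖ / (2 * bdryDist D p.1) +
      ‖tangentPart D p.1 p.2‖ / Real.sqrt (bdryDist D p.1)) (N ×ˢ univ) := by
    refine (hnp.norm.div (continuousOn_const.mul hb) fun p hp => ?_).add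
      (htp.norm.div hb.sqrt fun p hp => ?_)
    · exact mul_ne_zero two_ne_zero (hb0 p hp)
    · exact (Real.sqrt_pos.2 (bdryDist_pos hD hne (hND p hp))).ne'
  rintro ⟨x, v⟩ ⟨hx, -⟩ y hy
  have hx : x ∈ D := hx
  have hcv : Continuous fun p : Euc d × Euc d => 1 / 2 * ‖p.2‖ := by fun_prop
  by_cases hxN : x ∈ N
  · simp only [finslerF_of_mem hxN] at hy
    have hle := half_norm_le_of_bdryDist_le_one hD hne hx
      ((bdryDist_le_of_mem_collar hxN).trans hε1) v
    have e1 := (hG (x, v) ⟨hxN, mem_univ _⟩).eventually (gt_mem_nhds hy)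
    have e2 : ∀ᶠ p : Euc d × Euc d in 𝓝 (x, v), 1 / 2 * ‖p.2‖ < y :=
      (hcv.tendsto (x, v)).eventually (gt_mem_nhds (hle.trans_lt hy))
    rw [eventually_nhdsWithin_iff] at e1 ⊢
    filter_upwards [e1, e2] with p h1 h2 _
    by_cases hp : p.1 ∈ N
    · rw [finslerF_of_mem hp]; exact h1 ⟨hp, mem_univ _⟩
    · rw [finslerF_of_notMem hp]; exact h2
  · simp only [finslerF_of_notMem hxN] at hy
    have hcl : x ∉ closure {x | bdryDist D x < ε} := fun h => hxN ⟨h, hx⟩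
    have e1 : ∀ᶠ p : Euc d × Euc d in 𝓝 (x, v), p.1 ∉ closure {x | bdryDist D x < ε} :=
      (continuous_fst.tendsto (x, v)).eventually
        (show (closure {x | bdryDist D x < ε})ᶜ ∈ 𝓝 x from
          isClosed_closure.isOpen_compl.mem_nhds hcl)
    have e2 : ∀ᶠ p : Euc d × Euc d in 𝓝 (x, v), 1 / 2 * ‖p.2‖ < y :=
      (hcv.tendsto (x, v)).eventually (gt_mem_nhds hy)
    refine nhdsWithin_le_nhds ?_
    filter_upwards [e1, e2] with p h1 h2
    rw [finslerF_of_notMem fun h => h1 h.1]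
    exact h2

end Finsler

/-! ### Lengths of curves -/

section Curves

variable {d : ℕ} {D : Set (Euc d)} {ε c : ℝ}

/-- Upper semicontinuity makes the length integrand measurable and bounded above along a `C¹`
curve. At the end points `deriv γ` may be a junk value, which does not affect the integral. -/
theorem FinslerUSC.intervalIntegrable (hF : FinslerUSC D ε c) (hc : 0 ≤ c) {γ : ℝ → Euc d}
    {a b : ℝ} (hab : a ≤ b) (hγ : ContDiffOn ℝ 1 γ (Icc a b)) (hγD : ∀ t ∈ Icc a b, γ t ∈ D) :
    IntervalIntegrable (fun t => finslerF D ε c (γ t) (deriv γ t)) MeasureTheory.volume a b := by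
  rcases hab.eq_or_lt with rfl | hlt
  · simp
  set G : ℝ → ℝ := fun t => finslerF D ε c (γ t) (derivWithin γ (Icc a b) t) with hG
  have hcont : ContinuousOn (fun t => (γ t, derivWithin γ (Icc a b) t)) (Icc a b) :=
    hγ.continuousOn.prodMk (hγ.continuousOn_derivWithin (uniqueDiffOn_Icc hlt) le_rfl)
  have husc : UpperSemicontinuousOn G (Icc a b) :=
    UpperSemicontinuousOn.comp hF hcont fun t ht => ⟨hγD t ht, mem_univ _⟩
  have hmeas : AEMeasurable G (MeasureTheory.volume.restrict (Icc a b)) :=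
    aemeasurable_restrict_of_measurable_subtype measurableSet_Icc
      (upperSemicontinuousOn_iff_restrict.2 husc).measurable
  obtain ⟨M, hM⟩ := husc.bddAbove_of_isCompact isCompact_Icc
  have hint : MeasureTheory.IntegrableOn G (Icc a b) := by
    refine MeasureTheory.IntegrableOn.of_bound (by simp) hmeas.aestronglyMeasurable M ?_
    filter_upwards [MeasureTheory.ae_restrict_mem measurableSet_Icc] with t ht
    rw [Real.norm_of_nonneg (finslerF_nonneg hc _ _)]
    exact hM ⟨t, ht, rfl⟩
  rw [intervalIntegrable_iff_integrableOn_Ioo_of_le hab]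
  refine (hint.mono_set Ioo_subset_Icc_self).congr_fun (fun t ht => ?_) measurableSet_Ioo
  rw [hG]
  simp only
  rw [derivWithin_of_mem_nhds (Icc_mem_nhds ht.1 ht.2)]

/-- `γ` is one of the curves over which the infimum in the definition of `distF` is taken. -/
structure Joins (D : Set (Euc d)) (γ : ℝ → Euc d) (x y : Euc d) : Prop where
  piecewise : IsPiecewiseC1 γ
  mem : ∀ t ∈ Icc (0 : ℝ) 1, γ t ∈ D
  left : γ 0 = x
  right : γ 1 = y

theorem IsPiecewiseC1.intervalIntegrable {γ : ℝ → Euc d} (h : IsPiecewiseC1 γ)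
    (hF : FinslerUSC D ε c) (hc : 0 ≤ c) (hγD : ∀ t ∈ Icc (0 : ℝ) 1, γ t ∈ D) :
    IntervalIntegrable (fun t => finslerF D ε c (γ t) (deriv γ t)) MeasureTheory.volume 0 1 := by
  obtain ⟨-, n, t, ht, h0, h1, hC⟩ := h
  rw [← h0, ← h1]
  refine IntervalIntegrable.trans_iterate fun i hi => ?_
  refine hF.intervalIntegrable hc (ht (Nat.le_succ i)) (hC i hi) fun s hs => hγD s ?_
  exact ⟨(h0 ▸ ht (Nat.zero_le i)).trans hs.1, hs.2.trans (h1 ▸ ht (Nat.succ_le_of_lt hi))⟩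

theorem lengthF_nonneg (hc : 0 ≤ c) (γ : ℝ → Euc d) : 0 ≤ lengthF D ε c γ :=
  intervalIntegral.integral_nonneg zero_le_one fun _ _ => finslerF_nonneg hc _ _

theorem Joins.of_segment {x y : Euc d} (h : segment ℝ x y ⊆ D) :
    Joins D (fun t => x + t • (y - x)) x y := by
  have hs : ContDiff ℝ 1 fun t : ℝ => x + t • (y - x) := by fun_prop
  refine ⟨⟨hs.continuous.continuousOn, 1, fun i => i, Nat.mono_cast, by simp, by simp,
    fun i _ => hs.contDiffOn⟩, fun t ht => h ?_, by simp, by simp⟩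
  rw [segment_eq_image']
  exact ⟨t, ht, rfl⟩

theorem IsPiecewiseC1.reverse {γ : ℝ → Euc d} (h : IsPiecewiseC1 γ) :
    IsPiecewiseC1 fun t => γ (1 - t) := by
  obtain ⟨hc, n, t, ht, h0, h1, hC⟩ := h
  have hsub : ContDiff ℝ 1 fun s : ℝ => 1 - s := by fun_prop
  refine ⟨hc.comp hsub.continuous.continuousOn fun s hs => ⟨by linarith [hs.2], by linarith [hs.1]⟩,
    n, fun i => 1 - t (n - i), fun i j hij => ?_, by simp [h1], by simp [h0], fun i hi => ?_⟩
  · have := ht (Nat.sub_le_sub_left hij n)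
    simp only
    linarith
  · refine (hC (n - (i + 1)) (by omega)).comp hsub.contDiffOn fun s hs => ?_
    have e : n - (i + 1) + 1 = n - i := by omega
    rw [e]
    exact ⟨by linarith [hs.2], by linarith [hs.1]⟩

theorem Joins.symm {γ : ℝ → Euc d} {x y : Euc d} (h : Joins D γ x y) :
    Joins D (fun t => γ (1 - t)) y x :=
  ⟨h.piecewise.reverse, fun t ht => h.mem _ ⟨by linarith [ht.2], by linarith [ht.1]⟩,
    by simp [h.right], by simp [h.left]⟩

theorem finslerF_neg (x v : Euc d) : finslerF D ε c x (-v) = finslerF D ε c x v := by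
  simpa using finslerF_smul (D := D) (ε := ε) (c := c) x v (-1)

theorem lengthF_reverse (γ : ℝ → Euc d) :
    lengthF D ε c (fun t => γ (1 - t)) = lengthF D ε c γ := by
  have h := intervalIntegral.integral_comp_sub_left (a := 0) (b := 1)
    (fun t => finslerF D ε c (γ t) (deriv γ t)) 1
  simp only [sub_self, sub_zero] at h
  rw [lengthF, lengthF, ← h]
  refine intervalIntegral.integral_congr fun t _ => ?_
  rw [deriv_comp_const_sub, finslerF_neg]

/-- The concatenation of two curves, each run through at double speed. -/
noncomputable def concat (γ₁ γ₂ : ℝ → Euc d) : ℝ → Euc d :=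
  fun t => if t ≤ 1 / 2 then γ₁ (2 * t) else γ₂ (2 * t - 1)

theorem concat_of_le {γ₁ γ₂ : ℝ → Euc d} {t : ℝ} (h : t ≤ 1 / 2) :
    concat γ₁ γ₂ t = γ₁ (2 * t) := if_pos h

theorem concat_of_ge {γ₁ γ₂ : ℝ → Euc d} (h12 : γ₁ 1 = γ₂ 0) {t : ℝ} (h : 1 / 2 ≤ t) :
    concat γ₁ γ₂ t = γ₂ (2 * t - 1) := by
  rcases h.eq_or_lt with rfl | h
  · rw [concat_of_le le_rfl]; norm_num [h12]
  · exact if_neg (not_le.2 h)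

theorem IsPiecewiseC1.concat {γ₁ γ₂ : ℝ → Euc d} (h₁ : IsPiecewiseC1 γ₁) (h₂ : IsPiecewiseC1 γ₂)
    (h12 : γ₁ 1 = γ₂ 0) : IsPiecewiseC1 (concat γ₁ γ₂) := by
  obtain ⟨hc, n, t, ht, ht0, ht1, hC⟩ := h₁
  obtain ⟨hc', m, s, hs, hs0, hs1, hC'⟩ := h₂
  have a1 : ContDiff ℝ 1 fun t : ℝ => 2 * t := by fun_prop
  have a2 : ContDiff ℝ 1 fun t : ℝ => 2 * t - 1 := by fun_prop
  have htn : ∀ i ≤ n, t i ≤ 1 := fun i hi => ht1 ▸ ht hi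
  have ht0' : ∀ i, 0 ≤ t i := fun i => ht0 ▸ ht (Nat.zero_le i)
  have hs0' : ∀ i, 0 ≤ s i := fun i => hs0 ▸ hs (Nat.zero_le i)
  constructor
  · have e : Icc (0 : ℝ) 1 = Icc 0 (1 / 2) ∪ Icc (1 / 2) 1 :=
      (Icc_union_Icc_eq_Icc (by norm_num) (by norm_num)).symm
    rw [e]
    refine ContinuousOn.union_of_isClosed ?_ ?_ isClosed_Icc isClosed_Icc
    · refine (hc.comp a1.continuous.continuousOn fun t ht => ?_).congr
        fun t ht => concat_of_le ht.2
      exact ⟨by linarith [ht.1], by linarith [ht.2]⟩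
    · refine (hc'.comp a2.continuous.continuousOn fun t ht => ?_).congr
        fun t ht => concat_of_ge h12 ht.1
      exact ⟨by linarith [ht.1], by linarith [ht.2]⟩
  · refine ⟨n + m, fun i => if i ≤ n then t i / 2 else (1 + s (i - n)) / 2,
      monotone_nat_of_le_succ fun i => ?_, by simp [ht0], ?_, fun i hi => ?_⟩
    · by_cases h1 : i + 1 ≤ n
      · rw [if_pos h1, if_pos (by omega)]
        linarith [ht (Nat.le_succ i)]
      · rw [if_neg h1]
        by_cases h2 : i ≤ n
        · rw [if_pos h2]
          linarith [htn i h2, hs0' (i + 1 - n)]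
        · rw [if_neg h2]
          linarith [hs (show i - n ≤ i + 1 - n by omega)]
    · by_cases h : n + m ≤ n
      · have : m = 0 := by omega
        subst this
        exact absurd (hs0.symm.trans hs1) (by norm_num)
      · simp only
        rw [if_neg h, Nat.add_sub_cancel_left, hs1]; norm_num
    · by_cases h1 : i + 1 ≤ n
      · simp only [if_pos h1, if_pos (show i ≤ n by omega)]
        refine ((hC i (by omega)).comp a1.contDiffOn fun r hr => ?_).congr fun r hr =>
          concat_of_le ?_
        · exact ⟨by linarith [hr.1], by linarith [hr.2]⟩
        · linarith [hr.2, htn (i + 1) h1]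
      · have e : (if i ≤ n then t i / 2 else (1 + s (i - n)) / 2) = (1 + s (i - n)) / 2 := by
          split_ifs with h2
          · have : i = n := by omega
            subst this
            simp [ht1, hs0]
          · rfl
        have e' : i + 1 - n = i - n + 1 := by omega
        simp only [e, if_neg h1, e']
        refine ((hC' (i - n) (by omega)).comp a2.contDiffOn fun r hr => ?_).congr fun r hr =>
          concat_of_ge h12 ?_
        · exact ⟨by linarith [hr.1], by linarith [hr.2]⟩
        · linarith [hr.1, hs0' (i - n)]

theorem Joins.concat {γ₁ γ₂ : ℝ → Euc d} {x y z : Euc d} (h₁ : Joins D γ₁ x y)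
    (h₂ : Joins D γ₂ y z) : Joins D (concat γ₁ γ₂) x z := by
  have h12 : γ₁ 1 = γ₂ 0 := h₁.right.trans h₂.left.symm
  refine ⟨h₁.piecewise.concat h₂.piecewise h12, fun t ht => ?_, ?_, ?_⟩
  · rcases le_total t (1 / 2) with h | h
    · rw [concat_of_le h]; exact h₁.mem _ ⟨by linarith [ht.1], by linarith⟩
    · rw [concat_of_ge h12 h]; exact h₂.mem _ ⟨by linarith, by linarith [ht.2]⟩
  · rw [concat_of_le (by norm_num), mul_zero, h₁.left]
  · rw [concat_of_ge h12 (by norm_num)]; norm_num [h₂.right]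

theorem Joins.lengthF_concat {γ₁ γ₂ : ℝ → Euc d} {x y z : Euc d} (h₁ : Joins D γ₁ x y)
    (h₂ : Joins D γ₂ y z) (hF : FinslerUSC D ε c) (hc : 0 ≤ c) :
    lengthF D ε c (MinDom.concat γ₁ γ₂) = lengthF D ε c γ₁ + lengthF D ε c γ₂ := by
  have h := h₁.concat h₂
  have hint := h.piecewise.intervalIntegrable hF hc h.mem
  rw [lengthF, ← intervalIntegral.integral_add_adjacent_intervals (b := 1 / 2)
    (hint.mono_set (by
      rw [uIcc_of_le, uIcc_of_le] <;> norm_num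
      exact Icc_subset_Icc_right (by norm_num)))
    (hint.mono_set (by
      rw [uIcc_of_le, uIcc_of_le] <;> norm_num
      exact Icc_subset_Icc_left (by norm_num)))]
  congr 1
  · have e := intervalIntegral.integral_comp_mul_left (a := 0) (b := 1 / 2)
      (fun t => finslerF D ε c (γ₁ t) (deriv γ₁ t)) (two_ne_zero' ℝ)
    have e2 : ∫ t in (0 : ℝ)..(1 / 2), finslerF D ε c (MinDom.concat γ₁ γ₂ t)
        (deriv (MinDom.concat γ₁ γ₂) t) = ∫ t in (0 : ℝ)..(1 / 2),
          2 * finslerF D ε c (γ₁ (2 * t)) (deriv γ₁ (2 * t)) := by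
      refine intervalIntegral.integral_congr_uIoo fun t ht => ?_
      rw [uIoo_of_le (by norm_num)] at ht
      have hev : MinDom.concat γ₁ γ₂ =ᶠ[𝓝 t] fun t => γ₁ (2 * t) := by
        filter_upwards [Iio_mem_nhds ht.2] with s hs
        exact concat_of_le (le_of_lt hs)
      rw [hev.deriv_eq, concat_of_le ht.2.le, deriv_comp_mul_left, finslerF_smul]
      simp
    rw [e2, intervalIntegral.integral_const_mul, e, lengthF]
    norm_num
    ring
  · have e := intervalIntegral.integral_comp_mul_sub (a := 1 / 2) (b := 1)
      (fun t => finslerF D ε c (γ₂ t) (deriv γ₂ t)) (two_ne_zero' ℝ) 1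
    have e2 : ∫ t in (1 / 2 : ℝ)..1, finslerF D ε c (MinDom.concat γ₁ γ₂ t)
        (deriv (MinDom.concat γ₁ γ₂) t) = ∫ t in (1 / 2 : ℝ)..1,
          2 * finslerF D ε c (γ₂ (2 * t - 1)) (deriv γ₂ (2 * t - 1)) := by
      refine intervalIntegral.integral_congr_uIoo fun t ht => ?_
      rw [uIoo_of_le (by norm_num)] at ht
      have hev : MinDom.concat γ₁ γ₂ =ᶠ[𝓝 t] fun t => γ₂ (2 * t - 1) := by
        filter_upwards [Ioi_mem_nhds ht.1] with s hs
        exact if_neg (not_le.2 hs)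
      rw [hev.deriv_eq, concat_of_ge (h₁.right.trans h₂.left.symm) ht.1.le,
        deriv_comp_mul_left 2 (fun t => γ₂ (t - 1)), deriv_comp_sub_const, finslerF_smul]
      simp
    rw [e2, intervalIntegral.integral_const_mul, e, lengthF]
    norm_num
    ring

theorem exists_joins (hD : IsOpen D) (hconn : IsPreconnected D) {x y : Euc d} (hx : x ∈ D)
    (hy : y ∈ D) : ∃ γ, Joins D γ x y := by
  refine hconn.induction₂ (fun x y => ∃ γ, Joins D γ x y) (fun x hx => ?_)
    (fun x y z _ _ _ ⟨γ, h⟩ ⟨γ', h'⟩ => ⟨_, h.concat h'⟩) (fun x y _ _ ⟨γ, h⟩ => ⟨_, h.symm⟩) hx hy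
  obtain ⟨r, hr, hball⟩ := Metric.isOpen_iff.1 hD x hx
  filter_upwards [nhdsWithin_le_nhds (Metric.ball_mem_nhds x hr)] with y hy
  exact ⟨_, Joins.of_segment
    (((convex_ball x r).segment_subset (Metric.mem_ball_self hr) hy).trans hball)⟩

/-! ### The distance -/

theorem distF_le (hc : 0 ≤ c) {x y : D} {γ : ℝ → Euc d} (h : Joins D γ x y) :
    distF D ε c x y ≤ lengthF D ε c γ := by
  refine csInf_le ⟨0, ?_⟩ ⟨γ, h.piecewise, h.mem, h.left, h.right, rfl⟩
  rintro _ ⟨γ', -, -, -, -, rfl⟩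
  exact lengthF_nonneg hc γ'

theorem le_distF (hD : IsOpen D) (hconn : IsPreconnected D) {x y : D} {b : ℝ}
    (h : ∀ γ, Joins D γ x y → b ≤ lengthF D ε c γ) : b ≤ distF D ε c x y := by
  obtain ⟨γ, hγ⟩ := exists_joins hD hconn x.2 y.2
  refine le_csInf ⟨_, γ, hγ.piecewise, hγ.mem, hγ.left, hγ.right, rfl⟩ ?_
  rintro _ ⟨γ', h1, h2, h3, h4, rfl⟩
  exact h γ' ⟨h1, h2, h3, h4⟩

theorem distF_nonneg (hc : 0 ≤ c) (x y : D) : 0 ≤ distF D ε c x y := by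
  refine Real.sInf_nonneg ?_
  rintro _ ⟨γ', -, -, -, -, rfl⟩
  exact lengthF_nonneg hc γ'

theorem distF_comm (hD : IsOpen D) (hconn : IsPreconnected D) (hc : 0 ≤ c) (x y : D) :
    distF D ε c x y = distF D ε c y x := by
  have key : ∀ x y : D, distF D ε c x y ≤ distF D ε c y x := fun x y =>
    le_distF hD hconn fun γ hγ => lengthF_reverse (D := D) (ε := ε) (c := c) γ ▸ distF_le hc hγ.symm
  exact le_antisymm (key x y) (key y x)

theorem distF_triangle (hD : IsOpen D) (hconn : IsPreconnected D) (hc : 0 ≤ c)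
    (hF : FinslerUSC D ε c) (x y z : D) :
    distF D ε c x z ≤ distF D ε c x y + distF D ε c y z := by
  have h1 : ∀ γ₁, Joins D γ₁ x y → distF D ε c x z - lengthF D ε c γ₁ ≤ distF D ε c y z := by
    intro γ₁ h₁
    refine le_distF hD hconn fun γ₂ h₂ => ?_
    have := distF_le (ε := ε) hc (h₁.concat h₂)
    rw [h₁.lengthF_concat h₂ hF hc] at this
    linarith
  have h2 : distF D ε c x z - distF D ε c y z ≤ distF D ε c x y :=
    le_distF hD hconn fun γ₁ h₁ => by linarith [h1 γ₁ h₁]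
  linarith

theorem distF_self (hc : 0 ≤ c) (x : D) : distF D ε c x x = 0 := by
  refine le_antisymm ?_ (distF_nonneg hc x x)
  have hs : segment ℝ (x : Euc d) x ⊆ D := by simp
  refine (distF_le hc (Joins.of_segment hs)).trans_eq ?_
  have : ∀ z : Euc d, finslerF D ε c z 0 = 0 := fun z => by
    simpa using finslerF_smul (D := D) (ε := ε) (c := c) z 0 0
  simp [lengthF, this]

/-- A bound for the distance of the end points of a segment. -/
theorem distF_le_integral (hc : 0 ≤ c) (hF : FinslerUSC D ε c) {x y : D}
    (hs : segment ℝ (x : Euc d) y ⊆ D) {φ : ℝ → ℝ}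
    (hφ : IntervalIntegrable φ MeasureTheory.volume 0 1)
    (h : ∀ t ∈ Icc (0 : ℝ) 1, finslerF D ε c (x + t • ((y : Euc d) - x)) (y - x) ≤ φ t) :
    distF D ε c x y ≤ ∫ t in (0 : ℝ)..1, φ t := by
  have hj := Joins.of_segment hs
  have hd : ∀ t : ℝ, deriv (fun t : ℝ => (x : Euc d) + t • ((y : Euc d) - x)) t = y - x := by
    intro t
    have : HasDerivAt (fun t : ℝ => (x : Euc d) + t • ((y : Euc d) - x)) (y - x) t := by
      simpa using ((hasDerivAt_id t).smul_const ((y : Euc d) - x)).const_add (x : Euc d)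
    exact this.deriv
  refine (distF_le hc hj).trans ?_
  refine intervalIntegral.integral_mono_on zero_le_one
    (hj.piecewise.intervalIntegrable hF hc hj.mem) hφ fun t ht => ?_
  rw [hd]
  exact h t ht

theorem distF_le_of_bound (hc : 0 ≤ c) (hF : FinslerUSC D ε c) {x y : D}
    (hs : segment ℝ (x : Euc d) y ⊆ D) {M : ℝ}
    (h : ∀ z ∈ segment ℝ (x : Euc d) y, finslerF D ε c z (y - x) ≤ M) :
    distF D ε c x y ≤ M := by
  refine (distF_le_integral hc hF hs (φ := fun _ => M) (by simp) fun t ht => h _ ?_).trans (by simp)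
  rw [segment_eq_image']
  exact ⟨t, ht, rfl⟩

end Curves

/-! ### The lower bound for the distance -/

section LowerBound

variable {d : ℕ} {D : Set (Euc d)} {ν : Euc d → Euc d} {K ε c a : ℝ}

/-- The function `√w / (1 + √w)`. It is comparable to `√w` for bounded `w`, and its logarithmic
derivative is smaller than that of `√w` by the factor `1 / (1 + √w)`. -/
noncomputable def damp (w : ℝ) : ℝ := Real.sqrt w / (1 + Real.sqrt w)

/-- The damped height of a point: `damp` of its distance to the boundary, truncated at `ε`. -/
noncomputable def height (D : Set (Euc d)) (ε : ℝ) (x : Euc d) : ℝ := damp (min (bdryDist D x) ε)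

theorem damp_pos {w : ℝ} (hw : 0 < w) : 0 < damp w := by
  have := Real.sqrt_pos.2 hw
  rw [damp]; positivity

theorem damp_le_one (w : ℝ) : damp w ≤ 1 := by
  have := Real.sqrt_nonneg w
  rw [damp, div_le_one (by positivity)]; linarith

theorem height_pos (hD : IsOpen D) (hne : (frontier D).Nonempty) (hε : 0 < ε) {x : Euc d}
    (hx : x ∈ D) : 0 < height D ε x :=
  damp_pos (lt_min (bdryDist_pos hD hne hx) hε)

theorem hasDerivAt_damp {w : ℝ} (hw : 0 < w) :
    HasDerivAt damp (damp w * (1 / (2 * w * (1 + Real.sqrt w)))) w := by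
  have hs := Real.sqrt_pos.2 hw
  have h1 := Real.hasDerivAt_sqrt hw.ne'
  have h2 : HasDerivAt damp _ w := h1.div (h1.const_add 1) (by positivity)
  convert h2 using 1
  rw [damp]
  field_simp
  linear_combination Real.sq_sqrt hw.le

/-- The function of the distance `r` to a point and of the depth `w` that gives, along a curve,
the lower bound for its length. -/
noncomputable def barrier (a r w : ℝ) : ℝ := 2 * Real.log (a * r + damp w) - Real.log (damp w)

theorem contDiffOn_barrier (ha : 0 ≤ a) {M w₀ w₁ : ℝ} (hw : 0 < w₀) :
    ContDiffOn ℝ 1 (fun q : ℝ × ℝ => barrier a q.1 q.2) (Icc 0 M ×ˢ Icc w₀ w₁) := by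
  have hpos : ∀ q ∈ Icc 0 M ×ˢ Icc w₀ w₁, 0 < q.2 := fun q hq => hw.trans_le hq.2.1
  have hsq : ContDiffOn ℝ 1 (fun q : ℝ × ℝ => Real.sqrt q.2) (Icc 0 M ×ˢ Icc w₀ w₁) :=
    contDiffOn_snd.sqrt fun q hq => (hpos q hq).ne'
  have hdamp : ContDiffOn ℝ 1 (fun q : ℝ × ℝ => damp q.2) (Icc 0 M ×ˢ Icc w₀ w₁) :=
    hsq.div (contDiffOn_const.add hsq) fun q _ => by
      have := Real.sqrt_nonneg q.2
      positivity
  refine (contDiffOn_const.mul (((contDiffOn_const.mul contDiffOn_fst).add hdamp).log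
    fun q hq => ?_)).sub (hdamp.log fun q hq => (damp_pos (hpos q hq)).ne')
  have h1 := damp_pos (hpos q hq)
  have h2 := mul_nonneg ha hq.1.1
  positivity

theorem deriv_barrier_le (ha : 0 ≤ a) {ρ w : ℝ → ℝ} {ρ' w' t : ℝ} (hρ : HasDerivAt ρ ρ' t)
    (hw : HasDerivAt w w' t) (hρ0 : 0 ≤ ρ t) (hw0 : 0 < w t) :
    deriv (fun s => barrier a (ρ s) (w s)) t ≤
      2 * a * |ρ'| / damp (w t) + |w'| / (2 * w t * (1 + Real.sqrt (w t))) := by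
  have hφ := damp_pos hw0
  have hs := Real.sqrt_pos.2 hw0
  set φ := damp (w t) with hφdef
  set L := 1 / (2 * w t * (1 + Real.sqrt (w t))) with hL
  have hL0 : 0 < L := by positivity
  have hd := (hasDerivAt_damp hw0).comp t hw
  rw [← hφdef, ← hL] at hd
  have hr := mul_nonneg ha hρ0
  have hsum : 0 < a * ρ t + φ := by positivity
  have h := (((hρ.const_mul a).add hd).log hsum.ne').const_mul 2 |>.sub (hd.log hφ.ne')
  have h' : HasDerivAt (fun s => barrier a (ρ s) (w s))
      (2 * ((a * ρ' + φ * L * w') / (a * ρ t + φ)) - φ * L * w' / φ) t := h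
  rw [h'.deriv]
  have e : 2 * ((a * ρ' + φ * L * w') / (a * ρ t + φ)) - φ * L * w' / φ =
      2 * a * ρ' / (a * ρ t + φ) + L * w' * ((φ - a * ρ t) / (a * ρ t + φ)) := by
    field_simp; ring
  rw [e]
  have h1 : 2 * a * ρ' / (a * ρ t + φ) ≤ 2 * a * |ρ'| / φ :=
    div_le_div₀ (by positivity) (by gcongr; exact le_abs_self _) hφ (by linarith)
  have h2 : |(φ - a * ρ t) / (a * ρ t + φ)| ≤ 1 := by
    rw [abs_div, abs_of_pos hsum, div_le_one hsum, abs_le]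
    constructor <;> linarith
  have h3 : L * w' * ((φ - a * ρ t) / (a * ρ t + φ)) ≤ L * |w'| := by
    refine (le_abs_self _).trans ?_
    rw [abs_mul, abs_mul, abs_of_pos hL0]
    exact mul_le_of_le_one_right (by positivity) h2
  have h4 : L * |w'| = |w'| / (2 * w t * (1 + Real.sqrt (w t))) := by rw [hL]; ring
  linarith

/-- The depth along a curve is touched from above by the distance to the nearest boundary point,
so its derivative is the normal component of the velocity wherever it exists. -/
theorem IsNormalField.abs_deriv_depth_le (hν : IsNormalField D ν K) (hD : IsOpen D)
    (hne : (frontier D).Nonempty) {γ : ℝ → Euc d} {v : Euc d} {t w' : ℝ} (hγ : HasDerivAt γ v t)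
    (hx : γ t ∈ D) (hw : HasDerivAt (fun s => min (bdryDist D (γ s)) ε) w' t)
    (hlt : bdryDist D (γ t) < ε) : |w'| ≤ ‖normalPart D (γ t) v‖ := by
  have hδ := bdryDist_pos hD hne hx
  have hnear := isNearestBdry_proj hne (γ t)
  have hn := hν.outerNormal_proj hD hne hx
  rw [norm_normalPart _ _ (hν.norm_outerNormal hD hne hx), hn]
  set ξ := proj D (γ t)
  have h1 : HasDerivAt (fun s => (min (bdryDist D (γ s)) ε) ^ 2 - ‖γ s - ξ‖ ^ 2)
      (2 * bdryDist D (γ t) * w' - 2 * inner ℝ (γ t - ξ) v) t := by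
    have h2 : HasDerivAt (fun s => (min (bdryDist D (γ s)) ε) ^ 2 - ‖γ s - ξ‖ ^ 2) _ t :=
      (hw.pow 2).sub ((hγ.sub_const ξ).norm_sq)
    convert h2 using 1
    simp [min_eq_left hlt.le]
  have hev : ∀ᶠ s in 𝓝 t, 0 < min (bdryDist D (γ s)) ε :=
    hw.continuousAt.eventually (lt_mem_nhds (lt_min hδ (hδ.trans hlt)))
  have h3 : IsLocalMax (fun s => (min (bdryDist D (γ s)) ε) ^ 2 - ‖γ s - ξ‖ ^ 2) t := by
    filter_upwards [hev] with s hs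
    have e : (min (bdryDist D (γ t)) ε) ^ 2 - ‖γ t - ξ‖ ^ 2 = 0 := by
      rw [min_eq_left hlt.le, hnear.2, sub_self]
    rw [e, sub_nonpos]
    exact pow_le_pow_left₀ hs.le ((min_le_left _ _).trans (bdryDist_le_norm_sub hnear.1 _)) 2
  have h4 := h3.hasDerivAt_eq_zero h1
  have h5 : w' = (bdryDist D (γ t))⁻¹ * inner ℝ (γ t - ξ) v := by
    field_simp; linarith
  have e : ξ - γ t = -(γ t - ξ) := by abel
  rw [h5, inner_smul_right, e, inner_neg_right, mul_neg, abs_neg, real_inner_comm]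

/-- Where the truncation is active, the truncated depth has its maximal value. -/
theorem deriv_depth_eq_zero {γ : ℝ → Euc d} {t w' : ℝ}
    (hw : HasDerivAt (fun s => min (bdryDist D (γ s)) ε) w' t) (hle : ε ≤ bdryDist D (γ t)) :
    w' = 0 := by
  refine IsLocalMax.hasDerivAt_eq_zero (Eventually.of_forall fun s => ?_) hw
  simp only [min_eq_right hle]
  exact min_le_right _ _

/-- In the collar the damping frees a part `N / (2 h (1 + h))` of the normal term `N / (2 h²)` of
`F`, where `h = √δ_D` and `N` is the length of the normal part. The bound on `a` makes this enough
for the normal contribution of `ρ'`. -/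
theorem IsNormalField.barrier_deriv_le_finslerF (hν : IsNormalField D ν K) (hD : IsOpen D)
    (hne : (frontier D).Nonempty) (hε : 0 < ε) (hε1 : ε ≤ 1) (ha : 0 ≤ a) (ha16 : a ≤ 1 / 16)
    (hac : 4 * a ≤ Real.sqrt ε * min c (1 / 2)) {γ : ℝ → Euc d} {v : Euc d} {t ρ' w' : ℝ}
    (hγ : HasDerivAt γ v t) (hx : γ t ∈ D)
    (hw : HasDerivAt (fun s => min (bdryDist D (γ s)) ε) w' t) (hρ : |ρ'| ≤ ‖v‖) :
    2 * a * |ρ'| / damp (min (bdryDist D (γ t)) ε) + |w'| / (2 * min (bdryDist D (γ t)) ε *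
      (1 + Real.sqrt (min (bdryDist D (γ t)) ε))) ≤ finslerF D ε c (γ t) v := by
  have hδ := bdryDist_pos hD hne hx
  rcases lt_or_ge (bdryDist D (γ t)) ε with hlt | hge
  · have h1 := hν.abs_deriv_depth_le hD hne hγ hx hw hlt
    rw [min_eq_left hlt.le, finslerF_of_mem (mem_collar_of_bdryDist_lt hx hlt), damp]
    have hv := norm_le_add_parts (D := D) (γ t) v
    set N := ‖normalPart D (γ t) v‖
    set T := ‖tangentPart D (γ t) v‖
    have hN : 0 ≤ N := norm_nonneg _
    have hT : 0 ≤ T := norm_nonneg _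
    set δ := bdryDist D (γ t)
    set h := Real.sqrt δ
    have h0 : 0 < h := Real.sqrt_pos.2 hδ
    have hle1 : h ≤ 1 := Real.sqrt_le_one.2 (hlt.le.trans hε1)
    have hsq : δ = h ^ 2 := (Real.sq_sqrt hδ.le).symm
    have e1 : 2 * a * |ρ'| / (h / (1 + h)) ≤ (N + T) / (4 * h) := by
      rw [div_div_eq_mul_div]
      have : 2 * a * |ρ'| * (1 + h) ≤ (N + T) / 4 :=
        calc 2 * a * |ρ'| * (1 + h) ≤ 2 * (1 / 16) * (N + T) * (1 + 1) := by
              gcongr; exact hρ.trans hv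
          _ = (N + T) / 4 := by ring
      calc 2 * a * |ρ'| * (1 + h) / h ≤ (N + T) / 4 / h := by gcongr
        _ = _ := by rw [div_div]
    have e2 : |w'| / (2 * δ * (1 + h)) ≤ N / (2 * δ * (1 + h)) := by gcongr
    have e3 : N / (2 * δ * (1 + h)) = N / (2 * δ) - N / (2 * h * (1 + h)) := by
      rw [hsq]; field_simp; ring
    have e4 : N / (4 * h) ≤ N / (2 * h * (1 + h)) :=
      div_le_div_of_nonneg_left hN (by positivity) (by nlinarith)
    have e5 : (N + T) / (4 * h) = N / (4 * h) + T / h / 4 := by field_simp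
    have e6 : 0 ≤ T / h := by positivity
    linarith
  · rw [min_eq_right hge, deriv_depth_eq_zero hw hge, abs_zero, zero_div, add_zero]
    refine le_trans ?_ (le_finslerF hD hne hε1 hx v)
    have hs : 0 < Real.sqrt ε := Real.sqrt_pos.2 hε
    have hs1 : Real.sqrt ε ≤ 1 := Real.sqrt_le_one.2 hε1
    rw [damp, div_div_eq_mul_div, div_le_iff₀ hs]
    calc 2 * a * |ρ'| * (1 + Real.sqrt ε) ≤ 2 * a * ‖v‖ * (1 + 1) := by gcongr
      _ = 4 * a * ‖v‖ := by ring
      _ ≤ Real.sqrt ε * min c (1 / 2) * ‖v‖ := by gcongr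
      _ = _ := by ring

/-- The barrier is a Lipschitz function of the parameter of a `C¹` curve, hence absolutely
continuous, so the bound of its derivative, valid almost everywhere, can be integrated. -/
theorem IsNormalField.barrier_sub_le_integral (hν : IsNormalField D ν K) (hD : IsOpen D)
    (hne : (frontier D).Nonempty) (hε : 0 < ε) (hε1 : ε ≤ 1) (hc : 0 ≤ c) (ha : 0 ≤ a)
    (ha16 : a ≤ 1 / 16) (hac : 4 * a ≤ Real.sqrt ε * min c (1 / 2)) (hF : FinslerUSC D ε c)
    (p : Euc d) {γ : ℝ → Euc d} {r s : ℝ} (hrs : r ≤ s) (hγ : ContDiffOn ℝ 1 γ (Icc r s))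
    (hγD : ∀ t ∈ Icc r s, γ t ∈ D) :
    barrier a ‖γ s - p‖ (min (bdryDist D (γ s)) ε) -
      barrier a ‖γ r - p‖ (min (bdryDist D (γ r)) ε) ≤
      ∫ t in r..s, finslerF D ε c (γ t) (deriv γ t) := by
  obtain ⟨C, hC⟩ := hγ.exists_lipschitzOnWith one_ne_zero (convex_Icc r s) isCompact_Icc
  set ρ : ℝ → ℝ := fun t => ‖γ t - p‖ with hρ
  set w : ℝ → ℝ := fun t => min (bdryDist D (γ t)) ε with hw
  have hρL : LipschitzOnWith C ρ (Icc r s) := by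
    refine LipschitzOnWith.of_dist_le_mul fun t ht t' ht' => ?_
    refine le_trans ?_ (hC.dist_le_mul t ht t' ht')
    rw [Real.dist_eq, dist_eq_norm]
    simpa using abs_norm_sub_norm_le (γ t - p) (γ t' - p)
  have hwL : LipschitzOnWith C w (Icc r s) := by
    refine LipschitzOnWith.of_dist_le_mul fun t ht t' ht' => ?_
    refine le_trans ?_ (hC.dist_le_mul t ht t' ht')
    rw [Real.dist_eq, dist_eq_norm]
    refine le_trans ?_ (abs_bdryDist_sub_le (D := D) _ _)
    exact abs_min_sub_min_le_max _ _ _ _ |>.trans (by simp)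
  have hwpos : ∀ t ∈ Icc r s, 0 < w t := fun t ht => lt_min (bdryDist_pos hD hne (hγD t ht)) hε
  obtain ⟨M, hM⟩ := isCompact_Icc.bddAbove_image hρL.continuousOn
  obtain ⟨t₀, ht₀, hmin⟩ := isCompact_Icc.exists_isMinOn (nonempty_Icc.2 hrs) hwL.continuousOn
  have hcd := contDiffOn_barrier ha (M := M) (w₁ := ε) (hwpos t₀ ht₀)
  obtain ⟨C', hC'⟩ := hcd.exists_lipschitzOnWith one_ne_zero
    ((convex_Icc _ _).prod (convex_Icc _ _)) (isCompact_Icc.prod isCompact_Icc)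
  have hmaps : MapsTo (fun t => (ρ t, w t)) (Icc r s) (Icc 0 M ×ˢ Icc (w t₀) ε) := fun t ht =>
    ⟨⟨norm_nonneg _, hM ⟨t, ht, rfl⟩⟩, hmin ht, min_le_right _ _⟩
  have hL := hC'.comp (hρL.prodMk hwL) hmaps
  rw [← uIcc_of_le hrs] at hL
  have hac' := hL.absolutelyContinuousOnInterval
  have hFTC := hac'.integral_deriv_eq_sub
  have hint := hac'.intervalIntegrable_deriv
  refine (le_of_eq hFTC.symm).trans ?_
  refine intervalIntegral.integral_mono_ae_restrict hrs hint
    (hF.intervalIntegrable hc hrs hγ hγD) ?_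
  rw [← MeasureTheory.Measure.restrict_congr_set MeasureTheory.Ioo_ae_eq_Icc,
    Filter.EventuallyLE, MeasureTheory.ae_restrict_iff' measurableSet_Ioo]
  filter_upwards [hρL.ae_differentiableWithinAt_of_mem_real,
    hwL.ae_differentiableWithinAt_of_mem_real] with t h1 h2 ht
  have hnhds : Icc r s ∈ 𝓝 t := Icc_mem_nhds ht.1 ht.2
  have htI : t ∈ Icc r s := Ioo_subset_Icc_self ht
  have hρ1 := ((h1 htI).differentiableAt hnhds).hasDerivAt
  have hw1 := ((h2 htI).differentiableAt hnhds).hasDerivAt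
  have hγ1 := ((hγ.contDiffAt hnhds).differentiableAt one_ne_zero).hasDerivAt
  refine (deriv_barrier_le ha hρ1 hw1 (norm_nonneg _) (hwpos t htI)).trans ?_
  refine hν.barrier_deriv_le_finslerF hD hne hε hε1 ha ha16 hac hγ1 (hγD t htI) hw1 ?_
  -- The distance to `p` grows at most at the speed of the curve.
  have hslope := hasDerivAt_iff_tendsto_slope_zero.1 hρ1
  have hslope' := hasDerivAt_iff_tendsto_slope_zero.1 hγ1
  refine le_of_tendsto_of_tendsto hslope.abs hslope'.norm (Eventually.of_forall fun h => ?_)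
  simp only [smul_eq_mul, abs_mul, norm_smul, Real.norm_eq_abs]
  gcongr
  simpa using abs_norm_sub_norm_le (γ (t + h) - p) (γ t - p)

theorem IsNormalField.barrier_sub_le_lengthF (hν : IsNormalField D ν K) (hD : IsOpen D)
    (hne : (frontier D).Nonempty) (hε : 0 < ε) (hε1 : ε ≤ 1) (hc : 0 ≤ c) (ha : 0 ≤ a)
    (ha16 : a ≤ 1 / 16) (hac : 4 * a ≤ Real.sqrt ε * min c (1 / 2)) (hF : FinslerUSC D ε c)
    (p : Euc d) {γ : ℝ → Euc d} {x y : Euc d} (hγ : Joins D γ x y) :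
    barrier a ‖y - p‖ (min (bdryDist D y) ε) - barrier a ‖x - p‖ (min (bdryDist D x) ε) ≤
      lengthF D ε c γ := by
  obtain ⟨⟨-, n, t, ht, h0, h1, hC⟩, hmem, rfl, rfl⟩ := hγ
  have hsub : ∀ i < n, Icc (t i) (t (i + 1)) ⊆ Icc 0 1 := fun i hi =>
    Icc_subset_Icc (h0 ▸ ht (Nat.zero_le i)) (h1 ▸ ht (Nat.succ_le_of_lt hi))
  have hint : ∀ i < n, IntervalIntegrable (fun t => finslerF D ε c (γ t) (deriv γ t))
      MeasureTheory.volume (t i) (t (i + 1)) := fun i hi =>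
    hF.intervalIntegrable hc (ht (Nat.le_succ i)) (hC i hi) fun s hs => hmem s (hsub i hi hs)
  rw [lengthF]
  have h := intervalIntegral.sum_integral_adjacent_intervals hint
  rw [h0, h1] at h
  rw [← h]
  set B : ℕ → ℝ := fun i => barrier a ‖γ (t i) - p‖ (min (bdryDist D (γ (t i))) ε) with hB
  have hBsum : ∑ i ∈ Finset.range n, (B (i + 1) - B i) = B n - B 0 := Finset.sum_range_sub B n
  have e : B n - B 0 = barrier a ‖γ 1 - p‖ (min (bdryDist D (γ 1)) ε) -
      barrier a ‖γ 0 - p‖ (min (bdryDist D (γ 0)) ε) := by simp only [hB, h0, h1]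
  rw [← e, ← hBsum]
  refine Finset.sum_le_sum fun i hi => ?_
  have hi := Finset.mem_range.1 hi
  exact hν.barrier_sub_le_integral hD hne hε hε1 hc ha ha16 hac hF p (ht (Nat.le_succ i)) (hC i hi)
    fun s hs => hmem s (hsub i hi hs)

/-- The lower bound for the distance: up to additive constants it is
`2 log (‖x - y‖ + max (h x) (h y)) - log (h x) - log (h y)` with `h = √δ_D`. -/
theorem IsNormalField.exists_le_distF (hν : IsNormalField D ν K) (hD : IsOpen D)
    (hconn : IsPreconnected D) (hne : (frontier D).Nonempty) (hε : 0 < ε) (hε1 : ε ≤ 1)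
    (hc : 0 < c) (hF : FinslerUSC D ε c) :
    ∃ a : ℝ, 0 < a ∧ ∀ x y : D,
      2 * Real.log (a * ‖(x : Euc d) - y‖ + max (height D ε x) (height D ε y)) -
        Real.log (height D ε x) - Real.log (height D ε y) ≤ distF D ε c x y := by
  have hs : 0 < Real.sqrt ε := Real.sqrt_pos.2 hε
  have hm : 0 < min c (1 / 2) := by positivity
  set a := min (1 / 16) (Real.sqrt ε * min c (1 / 2) / 4) with ha
  have ha0 : 0 < a := by positivity
  have key : ∀ x y : D, 2 * Real.log (a * ‖(x : Euc d) - y‖ + height D ε x) -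
      Real.log (height D ε x) - Real.log (height D ε y) ≤ distF D ε c x y := by
    intro x y
    rw [distF_comm hD hconn hc.le]
    refine le_distF hD hconn fun γ hγ => ?_
    have h := hν.barrier_sub_le_lengthF hD hne hε hε1 hc.le ha0.le (min_le_left _ _)
      (by linarith [min_le_right (1 / 16) (Real.sqrt ε * min c (1 / 2) / 4)]) hF (y : Euc d) hγ
    simp only [barrier, sub_self, norm_zero, mul_zero, zero_add] at h
    rw [height, height]
    linarith
  refine ⟨a, ha0, fun x y => ?_⟩
  rcases le_total (height D ε x) (height D ε y) with h | h
  · rw [max_eq_right h, norm_sub_rev, distF_comm hD hconn hc.le]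
    linarith [key y x]
  · rw [max_eq_left h]; exact key x y

end LowerBound

/-! ### The upper bound for the distance -/

section UpperBound

variable {d : ℕ} {D : Set (Euc d)} {ν : Euc d → Euc d} {K ε c : ℝ}

/-- Close to a point of `D` the distance is at most a multiple of the Euclidean one. -/
theorem IsNormalField.distF_le_mul_norm (hν : IsNormalField D ν K) (hD : IsOpen D)
    (hne : (frontier D).Nonempty) (hc : 0 ≤ c) (hF : FinslerUSC D ε c) (x : D) :
    ∃ M : ℝ, 0 < M ∧ ∀ y : D, ‖(y : Euc d) - x‖ < bdryDist D x / 2 →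
      distF D ε c x y ≤ M * ‖(y : Euc d) - x‖ := by
  have hδ := bdryDist_pos hD hne x.2
  set r := bdryDist D x / 2 with hr
  have hr0 : 0 < r := by positivity
  have hsr : 0 < Real.sqrt r := Real.sqrt_pos.2 hr0
  refine ⟨1 / (2 * r) + 1 / Real.sqrt r + c, by positivity, fun y hy => ?_⟩
  have hseg : segment ℝ (x : Euc d) y ⊆ Metric.ball x r :=
    (convex_ball _ _).segment_subset (Metric.mem_ball_self hr0)
      (by rwa [Metric.mem_ball, dist_eq_norm])
  have hball : Metric.ball (x : Euc d) r ⊆ D := ball_subset_of_le_bdryDist hD x.2 (by linarith)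
  refine distF_le_of_bound hc hF (hseg.trans hball) fun z hz => ?_
  refine hν.finslerF_le hD hne hc (hball (hseg hz)) _ hr0 ?_
  have h1 := hseg hz
  rw [Metric.mem_ball, dist_eq_norm] at h1
  have h2 := (abs_le.1 (abs_bdryDist_sub_le (D := D) z x)).1
  linarith

theorem IsNormalField.exists_distF_lt (hν : IsNormalField D ν K) (hD : IsOpen D)
    (hne : (frontier D).Nonempty) (hc : 0 ≤ c) (hF : FinslerUSC D ε c) (x : D) {e : ℝ}
    (he : 0 < e) : ∃ r > 0, ∀ y : D, ‖(y : Euc d) - x‖ < r → distF D ε c x y < e := by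
  obtain ⟨M, hM, h⟩ := hν.distF_le_mul_norm hD hne hc hF x
  have hδ := bdryDist_pos hD hne x.2
  refine ⟨min (bdryDist D x / 2) (e / M), by positivity, fun y hy => ?_⟩
  refine (h y (hy.trans_le (min_le_left _ _))).trans_lt ?_
  have := hy.trans_le (min_le_right _ _)
  rwa [lt_div_iff₀ hM, mul_comm] at this

theorem IsNormalField.exists_distF_le_of_isCompact (hν : IsNormalField D ν K) (hD : IsOpen D)
    (hconn : IsPreconnected D) (hne : (frontier D).Nonempty) (hc : 0 ≤ c) (hF : FinslerUSC D ε c)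
    (o : D) {S : Set (Euc d)} (hS : IsCompact S) (hSD : S ⊆ D) :
    ∃ M : ℝ, ∀ x : D, (x : Euc d) ∈ S → distF D ε c x o ≤ M := by
  refine hS.induction_on (p := fun T => ∃ M : ℝ, ∀ x : D, (x : Euc d) ∈ T → distF D ε c x o ≤ M)
    ⟨0, by simp⟩ (fun s t hst ⟨M, h⟩ => ⟨M, fun x hx => h x (hst hx)⟩) ?_ fun x hx => ?_
  · rintro s t ⟨M, h⟩ ⟨M', h'⟩
    refine ⟨max M M', fun x hx => ?_⟩
    rcases hx with hx | hx
    · exact (h x hx).trans (le_max_left _ _)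
    · exact (h' x hx).trans (le_max_right _ _)
  · obtain ⟨r, hr, h⟩ := hν.exists_distF_lt hD hne hc hF ⟨x, hSD hx⟩ one_pos
    refine ⟨Metric.ball x r, nhdsWithin_le_nhds (Metric.ball_mem_nhds x hr),
      1 + distF D ε c ⟨x, hSD hx⟩ o, fun y hy => ?_⟩
    rw [Metric.mem_ball, dist_eq_norm] at hy
    have h1 := h y hy
    have h2 := distF_triangle hD hconn hc hF y ⟨x, hSD hx⟩ o
    rw [distF_comm hD hconn hc] at h1
    linarith

/-- If `ξ` is nearest to a point of `D` at depth less than `R ≤ 1 / (2 K)`, then the ball of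
radius `R` that is tangent to the boundary at `ξ` from the side of that point lies in `D`, and it
gives a lower bound for the depth. -/
theorem IsNormalField.ball_subset (hν : IsNormalField D ν K) (hD : IsOpen D) {R : ℝ} (hR : 0 < R)
    (hRK : 2 * R * K ≤ 1) {x ξ : Euc d} (hx : x ∈ D) (hξ : IsNearestBdry D x ξ)
    (hxR : bdryDist D x < R) :
    Metric.ball (ξ - R • ν ξ) R ⊆ D ∧ ∀ z, R - ‖z - (ξ - R • ν ξ)‖ ≤ bdryDist D z := by
  have hne : (frontier D).Nonempty := ⟨ξ, hξ.1⟩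
  have hδ := bdryDist_pos hD hne hx
  have hfar : ∀ ζ ∈ frontier D, R ≤ ‖ξ - R • ν ξ - ζ‖ := by
    intro ζ hζ
    refine le_of_sq_le_sq ?_ (norm_nonneg _)
    have := hν.sq_le_norm_sub hξ.1 hζ hR.le
    nlinarith [sq_nonneg ‖ζ - ξ‖]
  constructor
  · refine subset_of_isPreconnected_of_disjoint_frontier hD (convex_ball _ _).isPreconnected
      ⟨x, ?_, hx⟩ (disjoint_left.2 fun ζ hζ hζf => ?_)
    · have e : x - (ξ - R • ν ξ) = (R - bdryDist D x) • ν ξ := by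
        rw [sub_smul, ← hν.sub_eq_of_isNearestBdry hD hx hξ]; abel
      rw [Metric.mem_ball, dist_eq_norm, e, norm_smul, hν.norm_eq _ hξ.1,
        Real.norm_of_nonneg (by linarith)]
      linarith
    · have := hfar ζ hζf
      rw [Metric.mem_ball, dist_comm, dist_eq_norm] at hζ
      linarith
  · intro z
    refine le_bdryDist hne fun ζ hζ => ?_
    have h1 := hfar ζ hζ
    have h2 : ‖ξ - R • ν ξ - ζ‖ ≤ ‖z - (ξ - R • ν ξ)‖ + ‖z - ζ‖ := by
      rw [norm_sub_rev z]
      have e : ξ - R • ν ξ - ζ = (ξ - R • ν ξ - z) + (z - ζ) := by abel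
      rw [e]; exact norm_add_le _ _
    linarith

/-- If `ξ` is nearest to a point of `D`, then depth below `ξ` is the length along the normal. -/
theorem IsNormalField.depth_eq (hν : IsNormalField D ν K) (hD : IsOpen D) {R : ℝ} (hR : 0 < R)
    (hRK : 2 * R * K ≤ 1) {x ξ : Euc d} (hx : x ∈ D) (hξ : IsNearestBdry D x ξ)
    (hxR : bdryDist D x < R) {s : ℝ} (hs : 0 < s) (hsR : s ≤ R) :
    ξ - s • ν ξ ∈ D ∧ bdryDist D (ξ - s • ν ξ) = s ∧ IsNearestBdry D (ξ - s • ν ξ) ξ := by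
  obtain ⟨hsub, hle⟩ := hν.ball_subset hD hR hRK hx hξ hxR
  have e : ξ - s • ν ξ - (ξ - R • ν ξ) = (R - s) • ν ξ := by rw [sub_smul]; abel
  have hn : ‖ξ - s • ν ξ - (ξ - R • ν ξ)‖ = R - s := by
    rw [e, norm_smul, hν.norm_eq _ hξ.1, Real.norm_of_nonneg (by linarith), mul_one]
  have hn' : ‖ξ - s • ν ξ - ξ‖ = s := by
    rw [sub_sub_cancel_left, norm_neg, norm_smul, hν.norm_eq _ hξ.1, Real.norm_of_nonneg hs.le,
      mul_one]
  have h1 := hle (ξ - s • ν ξ)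
  have h2 := bdryDist_le_norm_sub hξ.1 (ξ - s • ν ξ)
  rw [hn] at h1
  rw [hn'] at h2
  have h3 : bdryDist D (ξ - s • ν ξ) = s := le_antisymm h2 (by linarith)
  refine ⟨hsub ?_, h3, hξ.1, by rw [hn', h3]⟩
  rw [Metric.mem_ball, dist_eq_norm, hn]
  linarith

/-- The cost of moving along the normal from depth `δ_D(x)` to the larger depth `s`. -/
theorem IsNormalField.distF_normal_le (hν : IsNormalField D ν K) (hD : IsOpen D)
    (hu : HasUniqueProj D ε) (hc : 0 ≤ c) (hF : FinslerUSC D ε c) {R : ℝ} (hR : 0 < R)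
    (hRK : 2 * R * K ≤ 1) {x x' : D} {ξ : Euc d} (hξ : IsNearestBdry D x ξ)
    (hxR : bdryDist D x < R) {s : ℝ} (hs : bdryDist D x ≤ s) (hsR : s ≤ R) (hsε : s < ε)
    (hx' : (x' : Euc d) = ξ - s • ν ξ) :
    distF D ε c x x' ≤ 1 / 2 * Real.log s - 1 / 2 * Real.log (bdryDist D x) := by
  have hne : (frontier D).Nonempty := ⟨ξ, hξ.1⟩
  have hδ := bdryDist_pos hD hne x.2
  set δ := bdryDist D (x : Euc d) with hδdef
  have hpos : ∀ t ∈ Icc (0 : ℝ) 1, 0 < δ + t * (s - δ) := fun t ht => by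
    have := mul_nonneg ht.1 (sub_nonneg.2 hs)
    linarith
  have hle : ∀ t ∈ Icc (0 : ℝ) 1, δ + t * (s - δ) ≤ s := fun t ht => by
    have := mul_le_of_le_one_left (sub_nonneg.2 hs) ht.2
    linarith
  have hxe : (x : Euc d) = ξ - δ • ν ξ := by
    rw [← hν.sub_eq_of_isNearestBdry hD x.2 hξ]; abel
  have hv : (x' : Euc d) - x = -((s - δ) • ν ξ) := by
    rw [hx', hxe, sub_smul]; abel
  have hz : ∀ t : ℝ, (x : Euc d) + t • ((x' : Euc d) - x) = ξ - (δ + t * (s - δ)) • ν ξ := by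
    intro t
    rw [hv, add_smul, mul_smul]
    nth_rewrite 1 [hxe]
    rw [smul_neg]; abel
  have hdepth := fun t (ht : t ∈ Icc (0 : ℝ) 1) =>
    hν.depth_eq hD hR hRK x.2 hξ hxR (hpos t ht) ((hle t ht).trans hsR)
  have hseg : segment ℝ (x : Euc d) x' ⊆ D := by
    rw [segment_eq_image']
    rintro _ ⟨t, ht, rfl⟩
    simp only [hz]
    exact (hdepth t ht).1
  have hder : ∀ t ∈ uIcc (0 : ℝ) 1, HasDerivAt (fun t => 1 / 2 * Real.log (δ + t * (s - δ)))
      ((s - δ) / (2 * (δ + t * (s - δ)))) t := by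
    intro t ht
    rw [uIcc_of_le zero_le_one] at ht
    have h1 : HasDerivAt (fun t : ℝ => δ + t * (s - δ)) (s - δ) t := by
      simpa using ((hasDerivAt_id t).mul_const (s - δ)).const_add δ
    have h2 := (h1.log (hpos t ht).ne').const_mul (1 / 2)
    rwa [div_mul_div_comm, one_mul] at h2
  have hint : IntervalIntegrable (fun t => (s - δ) / (2 * (δ + t * (s - δ))))
      MeasureTheory.volume 0 1 := by
    refine ContinuousOn.intervalIntegrable ?_
    rw [uIcc_of_le zero_le_one]
    refine continuousOn_const.div (by fun_prop) fun t ht => ?_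
    exact mul_ne_zero two_ne_zero (hpos t ht).ne'
  refine (distF_le_integral hc hF hseg hint fun t ht => ?_).trans_eq ?_
  · obtain ⟨h1, h2, h3⟩ := hdepth t ht
    rw [hz]
    set z := ξ - (δ + t * (s - δ)) • ν ξ
    have hzc : z ∈ collar D ε :=
      mem_collar_of_bdryDist_lt h1 (by rw [h2]; exact (hle t ht).trans_lt hsε)
    have hproj : proj D z = ξ := (hu z hzc).unique (isNearestBdry_proj hne z) h3
    have hnp : normalPart D z ((x' : Euc d) - x) = (x' : Euc d) - x := by
      rw [normalPart, hproj, hν.outerNormal_eq hD h1 h3, hv, inner_neg_left, inner_smul_left,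
        real_inner_self_eq_norm_sq, hν.norm_eq _ hξ.1]
      simp only [conj_trivial, one_pow, mul_one, neg_smul]
    rw [finslerF_of_mem hzc, tangentPart, hnp, sub_self, norm_zero, zero_div, add_zero, h2, hv,
      norm_neg, norm_smul, hν.norm_eq _ hξ.1, Real.norm_of_nonneg (sub_nonneg.2 hs), mul_one]
  · rw [intervalIntegral.integral_eq_sub_of_hasDerivAt hder hint]
    simp

/-- At depth `s` the segment between two points above boundary points at distance `O(√s)` stays
at depth at least `s / 2`, and it is almost tangential. -/
theorem IsNormalField.tangential_segment (hν : IsNormalField D ν K) (hK : 1 ≤ K) {R s : ℝ}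
    (hR : 0 < R) (hRK : 2 * R * K = 1) {ξ η : Euc d} (hξ : ξ ∈ frontier D) (hη : η ∈ frontier D)
    (hs : 0 < s) (hsR : s ≤ R / 4) (hξη : ‖η - ξ‖ ≤ R / 8 * Real.sqrt s) {x' y' : Euc d}
    (hx' : x' = ξ - s • ν ξ) (hy' : y' = η - s • ν η) :
    ‖y' - x'‖ ≤ R / 4 * Real.sqrt s ∧ |inner ℝ (ν ξ) (y' - x')| ≤ s / 8 ∧
      ∀ z ∈ segment ℝ x' y', ‖z - ξ‖ ≤ 2 * Real.sqrt s ∧ ‖z - (ξ - R • ν ξ)‖ ≤ R - s / 2 := by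
  have hR2 : R ≤ 1 / 2 := by
    have := mul_le_mul_of_nonneg_left hK hR.le
    linarith
  have hs1 : s ≤ 1 := by linarith
  set q := Real.sqrt s with hq
  have hq0 : 0 < q := Real.sqrt_pos.2 hs
  have hq1 : q ≤ 1 := Real.sqrt_le_one.2 hs1
  have hqs : q ^ 2 = s := Real.sq_sqrt hs.le
  have hsq : s ≤ q := by
    have := mul_le_mul_of_nonneg_left hq1 hq0.le
    linarith
  have hsK : s * K ≤ 1 := by
    have := mul_le_mul_of_nonneg_right hsR (zero_le_one.trans hK)
    linarith
  set v := y' - x' with hv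
  have hve : v = (η - ξ) - s • (ν η - ν ξ) := by
    rw [hv, hx', hy', smul_sub]; abel
  have hlip := hν.lip ξ hξ η hη
  have hns : ‖s • (ν η - ν ξ)‖ ≤ s * K * ‖η - ξ‖ := by
    rw [norm_smul, Real.norm_of_nonneg hs.le, mul_assoc]
    gcongr
  have hvn : ‖v‖ ≤ R / 4 * q := by
    rw [hve]
    refine (norm_sub_le _ _).trans ?_
    have := mul_le_mul_of_nonneg_right hsK (norm_nonneg (η - ξ))
    linarith
  have hνξ := hν.norm_eq ξ hξ
  have hin : |inner ℝ (ν ξ) v| ≤ s / 8 := by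
    rw [hve, inner_sub_right]
    have h1 := hν.inner_le ξ hξ η hη
    have h2 : |inner ℝ (ν ξ) (s • (ν η - ν ξ))| ≤ s * K * ‖η - ξ‖ := by
      refine (abs_real_inner_le_norm _ _).trans ?_
      rw [hνξ, one_mul]; exact hns
    have h3 : K * ‖η - ξ‖ ^ 2 ≤ K * (R / 8 * q) ^ 2 := by gcongr
    have h4 : s * K * ‖η - ξ‖ ≤ s * K * (R / 8 * q) := by gcongr
    have h5 : K * (R / 8 * q) ^ 2 = R / 128 * s := by
      rw [← hqs]; linear_combination (R * q ^ 2 / 128) * hRK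
    have h6 : s * K * (R / 8 * q) = s * q / 16 := by linear_combination (s * q / 16) * hRK
    have h7 : s * q ≤ s * 1 := mul_le_mul_of_nonneg_left hq1 hs.le
    have h8 : R * s ≤ 1 / 2 * s := mul_le_mul_of_nonneg_right hR2 hs.le
    refine (abs_sub _ _).trans ?_
    linarith
  refine ⟨hvn, hin, ?_⟩
  intro z hz
  rw [segment_eq_image'] at hz
  obtain ⟨t, ht, rfl⟩ := hz
  rw [← hv]
  have htv : ‖t • v‖ ≤ R / 4 * q := by
    rw [norm_smul, Real.norm_of_nonneg ht.1]
    exact (mul_le_of_le_one_left (norm_nonneg _) ht.2).trans hvn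
  constructor
  · have e : x' + t • v - ξ = t • v - s • ν ξ := by rw [hx']; abel
    simp only [e]
    refine (norm_sub_le _ _).trans ?_
    rw [norm_smul s, hνξ, Real.norm_of_nonneg hs.le, mul_one]
    have := mul_le_mul_of_nonneg_right hR2 hq0.le
    linarith
  · have e : x' + t • v - (ξ - R • ν ξ) = (R - s) • ν ξ + t • v := by
      rw [hx', sub_smul]; abel
    simp only [e]
    refine le_of_sq_le_sq ?_ (by linarith)
    rw [norm_add_sq_real, norm_smul, hνξ, inner_smul_left, inner_smul_right, mul_one,
      Real.norm_of_nonneg (by linarith)]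
    simp only [conj_trivial]
    have h1 : ‖t • v‖ ^ 2 ≤ (R / 4 * q) ^ 2 := by gcongr
    have h2 : (R / 4 * q) ^ 2 = R ^ 2 * s / 16 := by rw [← hqs]; ring
    have h3 : t * inner ℝ (ν ξ) v ≤ s / 8 :=
      calc t * inner ℝ (ν ξ) v ≤ t * |inner ℝ (ν ξ) v| :=
            mul_le_mul_of_nonneg_left (le_abs_self _) ht.1
        _ ≤ |inner ℝ (ν ξ) v| := mul_le_of_le_one_left (abs_nonneg _) ht.2
        _ ≤ s / 8 := hin
    have h4 : (R - s) * (t * inner ℝ (ν ξ) v) ≤ (R - s) * (s / 8) :=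
      mul_le_mul_of_nonneg_left h3 (by linarith)
    have h5 : R * (R * s) ≤ 1 / 2 * (R * s) :=
      mul_le_mul_of_nonneg_right hR2 (mul_pos hR hs).le
    have h6 : s * s ≤ R / 4 * s := mul_le_mul_of_nonneg_right hsR hs.le
    have h7 : 0 < R * s := mul_pos hR hs
    linarith

/-- At depth `s` the points above boundary points at distance `O(√s)` have bounded distance. -/
theorem IsNormalField.distF_tangential_le (hν : IsNormalField D ν K) (hD : IsOpen D) (hK : 1 ≤ K)
    (hc : 0 ≤ c) (hF : FinslerUSC D ε c) {R s : ℝ} (hR : 0 < R)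
    (hRK : 2 * R * K = 1) {x ξ η : Euc d} (hx : x ∈ D) (hξ : IsNearestBdry D x ξ)
    (hxR : bdryDist D x < R) (hη : η ∈ frontier D) (hs : 0 < s) (hsR : s ≤ R / 4)
    (hsε : 2 * Real.sqrt s < ε) (hξη : ‖η - ξ‖ ≤ R / 8 * Real.sqrt s) {x' y' : D}
    (hx' : (x' : Euc d) = ξ - s • ν ξ) (hy' : (y' : Euc d) = η - s • ν η) :
    distF D ε c x' y' ≤ 2 := by
  have hne : (frontier D).Nonempty := ⟨ξ, hξ.1⟩
  obtain ⟨hsub, hle⟩ := hν.ball_subset hD hR hRK.le hx hξ hxR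
  obtain ⟨hvn, hin, hz⟩ :=
    hν.tangential_segment hK hR hRK hξ.1 hη hs hsR hξη hx' hy'
  have hR2 : R ≤ 1 / 2 := by
    have := mul_le_mul_of_nonneg_left hK hR.le
    linarith
  set q := Real.sqrt s with hq
  have hq0 : 0 < q := Real.sqrt_pos.2 hs
  have hqs : q ^ 2 = s := Real.sq_sqrt hs.le
  set v := (y' : Euc d) - x' with hv
  have hzD : ∀ z ∈ segment ℝ (x' : Euc d) y', z ∈ D := fun z hzs => by
    refine hsub ?_
    rw [Metric.mem_ball, dist_eq_norm]
    linarith [(hz z hzs).2]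
  refine distF_le_of_bound hc hF hzD fun z hzs => ?_
  obtain ⟨h1, h2⟩ := hz z hzs
  have hzd := hzD z hzs
  have hδz : s / 2 ≤ bdryDist D z := by linarith [hle z]
  have hδz' := (bdryDist_le_norm_sub hξ.1 z).trans h1
  rw [finslerF_of_mem (mem_collar_of_bdryDist_lt hzd (hδz'.trans_lt hsε)), ← hv]
  have hnear := isNearestBdry_proj hne z
  have hno := hν.norm_outerNormal hD hne hzd
  have hN : ‖normalPart D z v‖ ≤ s := by
    rw [norm_normalPart z v hno, hν.outerNormal_eq hD hzd hnear, real_inner_comm]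
    set ζ := proj D z
    have h3 : ‖ζ - ξ‖ ≤ 4 * q := by
      have e : ζ - ξ = (z - ξ) - (z - ζ) := by abel
      rw [e]
      refine (norm_sub_le _ _).trans ?_
      rw [hnear.2]; linarith
    have h4 : ‖ν ζ - ν ξ‖ ≤ K * (4 * q) := (hν.lip ξ hξ.1 ζ hnear.1).trans (by gcongr)
    have e : (inner ℝ (ν ζ) v : ℝ) = inner ℝ (ν ξ) v + inner ℝ (ν ζ - ν ξ) v := by
      rw [inner_sub_left]; ring
    rw [e]
    refine (abs_add_le _ _).trans ?_
    have h5 : |inner ℝ (ν ζ - ν ξ) v| ≤ K * (4 * q) * (R / 4 * q) :=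
      (abs_real_inner_le_norm _ _).trans (by gcongr)
    have h6 : K * (4 * q) * (R / 4 * q) = s / 2 := by
      rw [← hqs]; linear_combination (q ^ 2 / 2) * hRK
    linarith
  have hT : ‖tangentPart D z v‖ ≤ R / 4 * q := (norm_tangentPart_le z v hno).trans hvn
  have hsz : q / 2 ≤ Real.sqrt (bdryDist D z) := by
    refine Real.le_sqrt_of_sq_le ?_
    have : (q / 2) ^ 2 = s / 4 := by rw [← hqs]; ring
    linarith
  have e1 : ‖normalPart D z v‖ / (2 * bdryDist D z) ≤ 1 := by
    rw [div_le_one (by linarith)]; linarith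
  have e2 : ‖tangentPart D z v‖ / Real.sqrt (bdryDist D z) ≤ 1 := by
    rw [div_le_one (by linarith)]
    have := mul_le_mul_of_nonneg_right hR2 hq0.le
    linarith
  linarith

end UpperBound

/-! ### The distance up to an additive constant -/

section Estimate

variable {d : ℕ} {D : Set (Euc d)} {ν : Euc d → Euc d} {K ε c : ℝ}

/-- The quantity `‖x - y‖ + max (√δ_D(x)) (√δ_D(y))`. It is positive on `D`, symmetric, and
satisfies the triangle inequality. -/
noncomputable def gauge (D : Set (Euc d)) (x y : Euc d) : ℝ :=
  ‖x - y‖ + max (Real.sqrt (bdryDist D x)) (Real.sqrt (bdryDist D y))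

/-- The explicit function of two points of `D` that differs from the distance by a bounded
quantity. -/
noncomputable def modelDist (D : Set (Euc d)) (x y : Euc d) : ℝ :=
  2 * Real.log (gauge D x y) - Real.log (bdryDist D x) / 2 - Real.log (bdryDist D y) / 2

theorem sqrt_bdryDist_le_gauge_left (x y : Euc d) :
    Real.sqrt (bdryDist D x) ≤ gauge D x y :=
  (le_max_left _ _).trans (le_add_of_nonneg_left (norm_nonneg _))

theorem sqrt_bdryDist_le_gauge_right (x y : Euc d) :
    Real.sqrt (bdryDist D y) ≤ gauge D x y :=
  (le_max_right _ _).trans (le_add_of_nonneg_left (norm_nonneg _))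

theorem norm_sub_le_gauge (x y : Euc d) : ‖x - y‖ ≤ gauge D x y :=
  le_add_of_nonneg_right ((Real.sqrt_nonneg _).trans (le_max_left _ _))

theorem gauge_comm (x y : Euc d) : gauge D x y = gauge D y x := by
  rw [gauge, gauge, norm_sub_rev, max_comm]

theorem gauge_triangle (x y z : Euc d) : gauge D x z ≤ gauge D x y + gauge D y z := by
  have h1 : ‖x - z‖ ≤ ‖x - y‖ + ‖y - z‖ := norm_sub_le_norm_sub_add_norm_sub x y z
  have h2 := Real.sqrt_nonneg (bdryDist D y)
  simp only [gauge]
  rcases max_cases (Real.sqrt (bdryDist D x)) (Real.sqrt (bdryDist D z)) with h | h <;>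
  · rw [h.1]
    linarith [le_max_left (Real.sqrt (bdryDist D x)) (Real.sqrt (bdryDist D y)),
      le_max_right (Real.sqrt (bdryDist D x)) (Real.sqrt (bdryDist D y)),
      le_max_right (Real.sqrt (bdryDist D y)) (Real.sqrt (bdryDist D z)),
      le_max_left (Real.sqrt (bdryDist D y)) (Real.sqrt (bdryDist D z))]

theorem gauge_pos (hD : IsOpen D) (hne : (frontier D).Nonempty) {x : Euc d} (hx : x ∈ D)
    (y : Euc d) : 0 < gauge D x y :=
  (Real.sqrt_pos.2 (bdryDist_pos hD hne hx)).trans_le (sqrt_bdryDist_le_gauge_left x y)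

theorem exists_bdryDist_le (hb : Bornology.IsBounded D) :
    ∃ B : ℝ, 1 ≤ B ∧ ∀ x ∈ D, bdryDist D x ≤ B := by
  obtain ⟨B, hB⟩ := (Metric.isCompact_of_isClosed_isBounded isClosed_closure
    hb.closure).bddAbove_image (continuous_bdryDist (D := D)).continuousOn
  exact ⟨max B 1, le_max_right _ _, fun x hx =>
    (hB ⟨x, subset_closure hx, rfl⟩).trans (le_max_left _ _)⟩

/-- Two points at depth at most `s` whose distance is `O(√s)` are joined by moving both to depth
`s` along the normals. -/
theorem IsNormalField.distF_le_of_depth_le (hν : IsNormalField D ν K) (hD : IsOpen D) (hK : 1 ≤ K)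
    (hconn : IsPreconnected D) (hu : HasUniqueProj D ε) (hc : 0 ≤ c) (hF : FinslerUSC D ε c)
    {R s : ℝ} (hR : 0 < R) (hRK : 2 * R * K = 1) (hsε : Real.sqrt s ≤ ε / 4)
    (hsR : Real.sqrt s ≤ R / 32) {x y : D} (hne : (frontier D).Nonempty)
    (hx : bdryDist D x ≤ s) (hy : bdryDist D y ≤ s)
    (hxy : ‖(x : Euc d) - y‖ ≤ R / 16 * Real.sqrt s) :
    distF D ε c x y ≤
      Real.log s - Real.log (bdryDist D x) / 2 - Real.log (bdryDist D y) / 2 + 2 := by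
  have hδx := bdryDist_pos hD hne x.2
  have hs : 0 < s := hδx.trans_le hx
  have hq0 : 0 < Real.sqrt s := Real.sqrt_pos.2 hs
  have hqs : Real.sqrt s * Real.sqrt s = s := Real.mul_self_sqrt hs.le
  have hR2 : R ≤ 1 / 2 := by
    have := mul_le_mul_of_nonneg_left hK hR.le
    linarith
  have hsq : s ≤ R / 32 * Real.sqrt s := by
    have := mul_le_mul_of_nonneg_right hsR hq0.le
    linarith
  have hsR' : s ≤ R / 4 := by
    have := mul_le_mul_of_nonneg_left hsR hR.le
    have := mul_le_mul_of_nonneg_left hR2 hR.le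
    linarith
  have hsε' : s < ε := by
    have := mul_le_mul_of_nonneg_left hsε hq0.le
    have : Real.sqrt s * (ε / 4) ≤ 1 * (ε / 4) :=
      mul_le_mul_of_nonneg_right (by linarith) (by linarith)
    linarith
  obtain ⟨ξ, hξ⟩ := exists_isNearestBdry hne (x : Euc d)
  obtain ⟨η, hη⟩ := exists_isNearestBdry hne (y : Euc d)
  have hxR : bdryDist D (x : Euc d) < R := by linarith
  have hyR : bdryDist D (y : Euc d) < R := by linarith
  obtain ⟨hx'D, -, -⟩ := hν.depth_eq hD hR hRK.le x.2 hξ hxR hs (by linarith)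
  obtain ⟨hy'D, -, -⟩ := hν.depth_eq hD hR hRK.le y.2 hη hyR hs (by linarith)
  have h1 := hν.distF_normal_le hD hu hc hF hR hRK.le (x' := ⟨_, hx'D⟩) hξ hxR hx (by linarith)
    hsε' rfl
  have h2 := hν.distF_normal_le hD hu hc hF hR hRK.le (x' := ⟨_, hy'D⟩) hη hyR hy (by linarith)
    hsε' rfl
  have hξη : ‖η - ξ‖ ≤ R / 8 * Real.sqrt s := by
    have e : η - ξ = -((x : Euc d) - y) + ((x : Euc d) - ξ) - ((y : Euc d) - η) := by abel
    have h3 : ‖η - ξ‖ ≤ ‖(x : Euc d) - y‖ + ‖(x : Euc d) - ξ‖ + ‖(y : Euc d) - η‖ := by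
      rw [e]
      refine (norm_sub_le _ _).trans ?_
      gcongr
      exact (norm_add_le _ _).trans_eq (by rw [norm_neg])
    rw [hξ.2, hη.2] at h3
    linarith
  have h3 := hν.distF_tangential_le hD hK hc hF hR hRK x.2 hξ hxR hη.1 hs hsR' (by linarith) hξη
    (x' := ⟨_, hx'D⟩) (y' := ⟨_, hy'D⟩) rfl rfl
  have h4 := distF_triangle hD hconn hc hF x ⟨_, hx'D⟩ y
  have h5 := distF_triangle hD hconn hc hF ⟨_, hx'D⟩ ⟨_, hy'D⟩ y
  rw [distF_comm hD hconn hc y] at h2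
  linarith

/-- The distance to a fixed point is at most `log (1 / √δ_D)` up to a constant. -/
theorem IsNormalField.exists_distF_base_le (hν : IsNormalField D ν K) (hD : IsOpen D)
    (hconn : IsPreconnected D) (hb : Bornology.IsBounded D) (hne : (frontier D).Nonempty)
    (hu : HasUniqueProj D ε) (hc : 0 ≤ c) (hF : FinslerUSC D ε c) (hε : 0 < ε) {R : ℝ} (hR : 0 < R)
    (hRK : 2 * R * K ≤ 1) (o : D) :
    ∃ C : ℝ, ∀ x : D, distF D ε c x o ≤ C - Real.log (bdryDist D x) / 2 := by
  set s := min (R / 2) (ε / 2) with hs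
  have hs0 : 0 < s := by positivity
  have hsR : s ≤ R / 2 := min_le_left _ _
  have hsε : s ≤ ε / 2 := min_le_right _ _
  obtain ⟨B, hB1, hB⟩ := exists_bdryDist_le hb
  have hcl : closure D ∩ {x | s ≤ bdryDist D x} ⊆ D := by
    rintro x ⟨hx, hxs⟩
    by_contra hxD
    have : x ∈ frontier D := by rw [hD.frontier_eq]; exact ⟨hx, hxD⟩
    have h0 : bdryDist D x = 0 := Metric.infDist_zero_of_mem this
    have hxs : s ≤ bdryDist D x := hxs
    linarith
  have hcpt : IsCompact (closure D ∩ {x | s ≤ bdryDist D x}) :=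
    (Metric.isCompact_of_isClosed_isBounded isClosed_closure hb.closure).inter_right
      (isClosed_le continuous_const continuous_bdryDist)
  obtain ⟨M, hM⟩ := hν.exists_distF_le_of_isCompact hD hconn hne hc hF o hcpt hcl
  refine ⟨M + |Real.log s / 2| + Real.log B / 2, fun x => ?_⟩
  have hδ := bdryDist_pos hD hne x.2
  have hlogB : 0 ≤ Real.log B := Real.log_nonneg hB1
  rcases le_or_gt s (bdryDist D x) with h | h
  · have h1 := hM x ⟨subset_closure x.2, h⟩
    have h2 := Real.log_le_log hδ (hB x x.2)
    have h3 := abs_nonneg (Real.log s / 2)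
    linarith
  · obtain ⟨ξ, hξ⟩ := exists_isNearestBdry hne (x : Euc d)
    have hxR : bdryDist D (x : Euc d) < R := by linarith
    obtain ⟨hx'D, hx's, -⟩ := hν.depth_eq hD hR hRK x.2 hξ hxR hs0 (by linarith)
    have h1 := hν.distF_normal_le hD hu hc hF hR hRK (x' := ⟨_, hx'D⟩) hξ hxR h.le (by linarith)
      (by linarith) rfl
    have h2 := hM ⟨_, hx'D⟩ ⟨subset_closure hx'D, hx's.ge⟩
    have h3 := distF_triangle hD hconn hc hF x ⟨_, hx'D⟩ o
    have h4 := le_abs_self (Real.log s / 2)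
    linarith

/-- The upper bound for the distance. -/
theorem IsNormalField.exists_distF_le (hν : IsNormalField D ν K) (hD : IsOpen D) (hK : 1 ≤ K)
    (hconn : IsConnected D) (hb : Bornology.IsBounded D) (hne : (frontier D).Nonempty)
    (hu : HasUniqueProj D ε) (hε : 0 < ε) (hc : 0 ≤ c) (hF : FinslerUSC D ε c) :
    ∃ C : ℝ, ∀ x y : D, distF D ε c x y ≤ modelDist D x y + C := by
  obtain ⟨o, ho⟩ := hconn.nonempty
  have hpre := hconn.isPreconnected
  set R := 1 / (2 * K) with hRdef
  have hR : 0 < R := by positivity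
  have hRK : 2 * R * K = 1 := by rw [hRdef]; field_simp
  have hR2 : R ≤ 1 / 2 := by
    have := mul_le_mul_of_nonneg_left hK hR.le
    linarith
  obtain ⟨C₀, hC₀⟩ :=
    hν.exists_distF_base_le hD hpre hb hne hu hc hF hε hR hRK.le ⟨o, ho⟩
  set q := min (ε / 4) (R / 32) with hq
  have hq0 : 0 < q := by positivity
  set g := R / 16 * q with hg
  have hg0 : 0 < g := by positivity
  refine ⟨max (2 + 2 * Real.log (16 / R)) (2 * C₀ - 2 * Real.log g), fun x y => ?_⟩
  have hG := gauge_pos hD hne x.2 (y : Euc d)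
  set G := gauge D (x : Euc d) y with hGdef
  -- The depth `s` is the smallest one for which `distF_le_of_depth_le` may apply; `√s` is
  -- comparable to `G`. If `√s` exceeds the threshold `q`, the detour through the base point is good
  -- enough.
  set s := max (max (bdryDist D (x : Euc d)) (bdryDist D (y : Euc d)))
    ((16 / R * ‖(x : Euc d) - y‖) ^ 2) with hs
  have hδx := bdryDist_pos hD hne x.2
  have hxs : bdryDist D (x : Euc d) ≤ s := (le_max_left _ _).trans (le_max_left _ _)
  have hys : bdryDist D (y : Euc d) ≤ s := (le_max_right _ _).trans (le_max_left _ _)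
  have hs0 : 0 < s := hδx.trans_le hxs
  have hxy : 16 / R * ‖(x : Euc d) - y‖ ≤ Real.sqrt s :=
    Real.le_sqrt_of_sq_le (le_max_right _ _)
  have h16 : 1 ≤ 16 / R := by rw [one_le_div hR]; linarith
  have hsG : Real.sqrt s ≤ 16 / R * G := by
    refine Real.sqrt_le_iff.2 ⟨by positivity, ?_⟩
    have hG1 : G ≤ 16 / R * G := le_mul_of_one_le_left hG.le h16
    refine max_le (max_le ?_ ?_) ?_
    · exact (Real.sqrt_le_left (by positivity)).1
        ((sqrt_bdryDist_le_gauge_left (x : Euc d) y).trans hG1)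
    · exact (Real.sqrt_le_left (by positivity)).1
        ((sqrt_bdryDist_le_gauge_right (x : Euc d) y).trans hG1)
    · gcongr
      exact norm_sub_le_gauge _ _
  rw [modelDist, ← hGdef]
  rcases le_or_gt (Real.sqrt s) q with h | h
  · have h1 := hν.distF_le_of_depth_le hD hK hpre hu hc hF hR hRK (h.trans (min_le_left _ _))
      (h.trans (min_le_right _ _)) hne hxs hys (by
        have : R / 16 * (16 / R * ‖(x : Euc d) - y‖) ≤ R / 16 * Real.sqrt s := by gcongr
        have e : R / 16 * (16 / R * ‖(x : Euc d) - y‖) = ‖(x : Euc d) - y‖ := by field_simp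
        linarith)
    have h2 : Real.log s / 2 ≤ Real.log (16 / R) + Real.log G := by
      rw [← Real.log_sqrt hs0.le, ← Real.log_mul (by positivity) hG.ne']
      exact Real.log_le_log (Real.sqrt_pos.2 hs0) hsG
    have := le_max_left (2 + 2 * Real.log (16 / R)) (2 * C₀ - 2 * Real.log g)
    linarith
  · have h1 := hC₀ x
    have h2 := hC₀ y
    have h3 := distF_triangle hD hpre hc hF x ⟨o, ho⟩ y
    rw [distF_comm hD hpre hc y] at h2
    have h4 : Real.log g ≤ Real.log G := by
      refine Real.log_le_log hg0 ?_
      have : R / 16 * q ≤ R / 16 * (16 / R * G) := by gcongr; exact h.le.trans hsG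
      have e : R / 16 * (16 / R * G) = G := by field_simp
      linarith
    have := le_max_right (2 + 2 * Real.log (16 / R)) (2 * C₀ - 2 * Real.log g)
    linarith

/-- The damped height is comparable to `√δ_D`. -/
theorem exists_height_comparison (hD : IsOpen D) (hb : Bornology.IsBounded D)
    (hne : (frontier D).Nonempty) (hε : 0 < ε) (hε1 : ε ≤ 1) :
    ∃ k : ℝ, 0 < k ∧ ∀ x ∈ D, k * Real.sqrt (bdryDist D x) ≤ height D ε x ∧
      height D ε x ≤ Real.sqrt (bdryDist D x) := by
  obtain ⟨B, hB1, hB⟩ := exists_bdryDist_le hb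
  have hk : 0 < ε / B := by positivity
  refine ⟨Real.sqrt (ε / B) / 2, by have := Real.sqrt_pos.2 hk; positivity, fun x hx => ?_⟩
  have hδ := bdryDist_pos hD hne hx
  have hw : 0 < min (bdryDist D x) ε := lt_min hδ hε
  have hsw := Real.sqrt_pos.2 hw
  have hsw1 : Real.sqrt (min (bdryDist D x) ε) ≤ 1 :=
    Real.sqrt_le_one.2 ((min_le_right _ _).trans hε1)
  constructor
  · have h1 : ε / B * bdryDist D x ≤ min (bdryDist D x) ε := by
      refine le_min ?_ ?_
      · exact mul_le_of_le_one_left hδ.le ((div_le_one (by linarith)).2 (hε1.trans hB1))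
      · rw [div_mul_eq_mul_div, div_le_iff₀ (by linarith)]
        exact mul_le_mul_of_nonneg_left (hB x hx) hε.le
    have h2 := Real.sqrt_le_sqrt h1
    rw [Real.sqrt_mul hk.le] at h2
    rw [height, damp, le_div_iff₀ (by positivity)]
    have h3 : 0 ≤ Real.sqrt (ε / B) * Real.sqrt (bdryDist D x) := by positivity
    have h4 := mul_le_mul_of_nonneg_left hsw1 h3
    linarith
  · rw [height, damp]
    refine (div_le_self hsw.le (by linarith)).trans (Real.sqrt_le_sqrt (min_le_left _ _))

/-- The lower bound for the distance in terms of `modelDist`. -/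
theorem IsNormalField.exists_modelDist_le (hν : IsNormalField D ν K) (hD : IsOpen D)
    (hconn : IsPreconnected D) (hb : Bornology.IsBounded D) (hne : (frontier D).Nonempty)
    (hε : 0 < ε) (hε1 : ε ≤ 1) (hc : 0 < c) (hF : FinslerUSC D ε c) :
    ∃ C : ℝ, ∀ x y : D, modelDist D x y ≤ distF D ε c x y + C := by
  obtain ⟨a, ha, hlow⟩ := hν.exists_le_distF hD hconn hne hε hε1 hc hF
  obtain ⟨k, hk, hcomp⟩ := exists_height_comparison hD hb hne hε hε1
  have hm : 0 < min a k := by positivity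
  refine ⟨-(2 * Real.log (min a k)), fun x y => ?_⟩
  have h := hlow x y
  have hG := gauge_pos hD hne x.2 (y : Euc d)
  obtain ⟨hx1, hx2⟩ := hcomp x x.2
  obtain ⟨hy1, hy2⟩ := hcomp y y.2
  have hx0 := height_pos hD hne hε x.2
  have hy0 := height_pos hD hne hε y.2
  have e1 : min a k * gauge D (x : Euc d) y ≤
      a * ‖(x : Euc d) - y‖ + max (height D ε x) (height D ε y) := by
    rw [gauge, mul_add, mul_max_of_nonneg _ _ hm.le]
    refine add_le_add ?_ (max_le_max ?_ ?_)
    · gcongr; exact min_le_left _ _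
    · refine le_trans ?_ hx1; gcongr; exact min_le_right _ _
    · refine le_trans ?_ hy1; gcongr; exact min_le_right _ _
  have e2 := Real.log_le_log (by positivity) e1
  rw [Real.log_mul hm.ne' hG.ne'] at e2
  have e3 := Real.log_le_log hx0 hx2
  have e4 := Real.log_le_log hy0 hy2
  rw [Real.log_sqrt (bdryDist_nonneg _)] at e3 e4
  rw [modelDist]
  linarith

/-- The lower bound controls the Euclidean distance of points at small distance. -/
theorem IsNormalField.exists_log_le_distF (hν : IsNormalField D ν K) (hD : IsOpen D)
    (hconn : IsPreconnected D) (hne : (frontier D).Nonempty) (hε : 0 < ε) (hε1 : ε ≤ 1)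
    (hc : 0 < c) (hF : FinslerUSC D ε c) :
    ∃ a : ℝ, 0 < a ∧ ∀ x y : D,
      2 * Real.log (1 + a * ‖(x : Euc d) - y‖) ≤ distF D ε c x y := by
  obtain ⟨a, ha, hlow⟩ := hν.exists_le_distF hD hconn hne hε hε1 hc hF
  refine ⟨a, ha, fun x y => ?_⟩
  have h := hlow x y
  have hx0 := height_pos hD hne hε x.2
  have hy0 := height_pos hD hne hε y.2
  set m := max (height D ε (x : Euc d)) (height D ε (y : Euc d)) with hm
  have hm0 : 0 < m := lt_max_of_lt_left hx0
  have hm1 : m ≤ 1 := max_le (damp_le_one _) (damp_le_one _)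
  have hpos : 0 < 1 + a * ‖(x : Euc d) - y‖ := by positivity
  have e1 : m * (1 + a * ‖(x : Euc d) - y‖) ≤ a * ‖(x : Euc d) - y‖ + m := by
    have := mul_le_mul_of_nonneg_right hm1 (show 0 ≤ a * ‖(x : Euc d) - y‖ by positivity)
    linarith
  have e2 := Real.log_le_log (by positivity) e1
  rw [Real.log_mul hm0.ne' hpos.ne'] at e2
  have e3 := Real.log_le_log hx0 (le_max_left (height D ε (x : Euc d)) (height D ε (y : Euc d)))
  have e4 := Real.log_le_log hy0 (le_max_right (height D ε (x : Euc d)) (height D ε (y : Euc d)))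
  rw [← hm] at e3 e4
  linarith

theorem IsNormalField.isMetric_distF (hν : IsNormalField D ν K) (hD : IsOpen D)
    (hconn : IsPreconnected D) (hne : (frontier D).Nonempty) (hε : 0 < ε) (hε1 : ε ≤ 1)
    (hc : 0 < c) (hF : FinslerUSC D ε c) : IsMetric (distF D ε c) where
  nonneg := distF_nonneg hc.le
  eq_zero_iff x y := by
    refine ⟨fun h => ?_, fun h => h ▸ distF_self hc.le x⟩
    obtain ⟨a, ha, hlow⟩ := hν.exists_log_le_distF hD hconn hne hε hε1 hc hF
    by_contra hxy
    have hpos : 0 < ‖(x : Euc d) - y‖ := norm_pos_iff.2 (sub_ne_zero.2 fun e => hxy (Subtype.ext e))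
    have h1 := hlow x y
    have h2 : 0 < Real.log (1 + a * ‖(x : Euc d) - y‖) :=
      Real.log_pos (by linarith [mul_pos ha hpos])
    linarith
  symm := distF_comm hD hconn hc.le
  triangle := distF_triangle hD hconn hc.le hF

end Estimate

/-! ### Hyperbolicity and the Gromov compactification -/

section Gromov

variable {d : ℕ} {D : Set (Euc d)} {ρ : D → D → ℝ} {C : ℝ} {o : D}

/-- The four-point inequality for a function of pairs that satisfies the triangle inequality. The
smallest of the four mixed values bounds both factors on the left by twice the values of the
pairing that does not contain it. -/
theorem mul_le_four_mul_or {xy zo xz yo yz xo : ℝ} (hxz : 0 ≤ xz) (hyo : 0 ≤ yo) (hyz : 0 ≤ yz)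
    (hxo : 0 ≤ xo) (hzo : 0 ≤ zo) (h1 : xy ≤ xz + yz) (h2 : xy ≤ xo + yo) (h3 : zo ≤ xz + xo)
    (h4 : zo ≤ yz + yo) : xy * zo ≤ 4 * (xz * yo) ∨ xy * zo ≤ 4 * (yz * xo) := by
  have key : ∀ {p q : ℝ}, 0 ≤ p → xy ≤ 2 * p → zo ≤ 2 * q → xy * zo ≤ 4 * (p * q) := by
    intro p q hp hp' hq'
    calc xy * zo ≤ (2 * p) * (2 * q) := mul_le_mul hp' hq' hzo (by positivity)
      _ = _ := by ring
  rcases le_total xz yz with ha | ha <;> rcases le_total xz xo with hb | hb <;>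
    rcases le_total yo yz with hc | hc <;> rcases le_total yo xo with he | he
  all_goals first
    | exact Or.inr (key hyz (by linarith) (by linarith))
    | exact Or.inl (key hxz (by linarith) (by linarith))
    | exact Or.inr ((key (p := xo) (q := yz) hxo (by linarith) (by linarith)).trans_eq
        (by rw [mul_comm xo]))
    | exact Or.inl ((key (p := yo) (q := xz) hyo (by linarith) (by linarith)).trans_eq
        (by rw [mul_comm yo]))

theorem isGromovHyperbolic_of_model (hD : IsOpen D) (hne : (frontier D).Nonempty)
    (hρ : ∀ x y : D, |ρ x y - modelDist D x y| ≤ C) : IsGromovHyperbolic ρ := by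
  have hpos := fun x y : D => gauge_pos hD hne x.2 (y : Euc d)
  rcases isEmpty_or_nonempty D with hE | ⟨⟨x₀⟩⟩
  · exact ⟨0, le_rfl, fun x => (hE.false x).elim⟩
  have hC : 0 ≤ C := (abs_nonneg _).trans (hρ x₀ x₀)
  have hlog4 : 0 ≤ Real.log 4 := Real.log_nonneg (by norm_num)
  refine ⟨2 * C + Real.log 4, by positivity, fun x y z o => ?_⟩
  have e1 := abs_le.1 (hρ x y)
  have e2 := abs_le.1 (hρ z o)
  have e3 := abs_le.1 (hρ x z)
  have e4 := abs_le.1 (hρ y o)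
  have e5 := abs_le.1 (hρ y z)
  have e6 := abs_le.1 (hρ x o)
  simp only [modelDist] at e1 e2 e3 e4 e5 e6
  have h := mul_le_four_mul_or (hpos x z).le (hpos y o).le (hpos y z).le (hpos x o).le
    (hpos z o).le
    ((gauge_triangle (D := D) (x : Euc d) z y).trans_eq (by rw [gauge_comm (z : Euc d)]))
    ((gauge_triangle (D := D) (x : Euc d) o y).trans_eq (by rw [gauge_comm (o : Euc d)]))
    ((gauge_triangle (D := D) (z : Euc d) x o).trans_eq (by rw [gauge_comm (z : Euc d)]))
    ((gauge_triangle (D := D) (z : Euc d) y o).trans_eq (by rw [gauge_comm (z : Euc d)]))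
  have hl : ∀ {a b p q : ℝ}, 0 < a → 0 < b → 0 < p → 0 < q → a * b ≤ 4 * (p * q) →
      Real.log a + Real.log b ≤ Real.log 4 + (Real.log p + Real.log q) := by
    intro a b p q ha hb hp hq h
    rw [← Real.log_mul ha.ne' hb.ne', ← Real.log_mul hp.ne' hq.ne',
      ← Real.log_mul (by norm_num) (by positivity)]
    exact Real.log_le_log (by positivity) h
  simp only [gromovProd]
  rcases h with h | h
  · have h' := hl (hpos x y) (hpos z o) (hpos x z) (hpos y o) h
    refine (sub_le_sub_right (min_le_left _ _) _).trans ?_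
    linarith
  · have h' := hl (hpos x y) (hpos z o) (hpos y z) (hpos x o) h
    refine (sub_le_sub_right (min_le_right _ _) _).trans ?_
    linarith

theorem continuous_gauge {X : Type*} [TopologicalSpace X] {f g : X → Euc d} (hf : Continuous f)
    (hg : Continuous g) : Continuous fun a => gauge D (f a) (g a) :=
  (hf.sub hg).norm.add
    ((continuous_bdryDist.comp hf).sqrt.max (continuous_bdryDist.comp hg).sqrt)

/-- The Gromov product of two points is the logarithm of `1 / gauge`, up to a constant. -/
theorem exists_abs_gromovProd_add_log_le (hD : IsOpen D) (hne : (frontier D).Nonempty)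
    (hb : Bornology.IsBounded D) (hρ : ∀ x y : D, |ρ x y - modelDist D x y| ≤ C) (o : D) :
    ∃ C' : ℝ, ∀ x y : D, |gromovProd ρ o x y + Real.log (gauge D x y)| ≤ C' := by
  have hδ := bdryDist_pos hD hne o.2
  obtain ⟨B, hB⟩ := (Metric.isCompact_of_isClosed_isBounded isClosed_closure
    hb.closure).bddAbove_image
    (continuous_gauge (D := D) continuous_id (continuous_const (y := (o : Euc d)))).continuousOn
  have hup : ∀ x : D, Real.log (gauge D x o) ≤ Real.log B := fun x =>
    Real.log_le_log (gauge_pos hD hne x.2 _) (hB ⟨x, subset_closure x.2, rfl⟩)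
  have hlow : ∀ x : D, Real.log (bdryDist D o) / 2 ≤ Real.log (gauge D x o) := fun x => by
    rw [← Real.log_sqrt hδ.le]
    exact Real.log_le_log (Real.sqrt_pos.2 hδ) (sqrt_bdryDist_le_gauge_right _ _)
  refine ⟨2 * C + 2 * |Real.log B| + 2 * |Real.log (bdryDist D o)|, fun x y => ?_⟩
  have e1 := abs_le.1 (hρ x o)
  have e2 := abs_le.1 (hρ y o)
  have e3 := abs_le.1 (hρ x y)
  have hC : 0 ≤ C := (abs_nonneg _).trans (hρ x y)
  simp only [modelDist] at e1 e2 e3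
  have a1 := le_abs_self (Real.log B)
  have a2 := le_abs_self (Real.log (bdryDist D o))
  have a3 := neg_abs_le (Real.log (bdryDist D o))
  have a4 := abs_nonneg (Real.log B)
  simp only [gromovProd]
  rw [abs_le]
  constructor <;> linarith [hup x, hup y, hlow x, hlow y]

section Boundary

variable {C' : ℝ}

theorem gauge_le_exp (hD : IsOpen D) (hne : (frontier D).Nonempty)
    (h : ∀ x y : D, |gromovProd ρ o x y + Real.log (gauge D x y)| ≤ C') {r : ℝ} {x y : D}
    (hr : r ≤ gromovProd ρ o x y) : gauge D x y ≤ Real.exp (C' - r) := by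
  rw [← Real.log_le_iff_le_exp (gauge_pos hD hne x.2 _)]
  linarith [(abs_le.1 (h x y)).2]

theorem le_gromovProd (hD : IsOpen D) (hne : (frontier D).Nonempty)
    (h : ∀ x y : D, |gromovProd ρ o x y + Real.log (gauge D x y)| ≤ C') {r : ℝ} {x y : D}
    (hr : gauge D x y ≤ Real.exp (-C' - r)) : r ≤ gromovProd ρ o x y := by
  rw [← Real.log_le_iff_le_exp (gauge_pos hD hne x.2 _)] at hr
  linarith [(abs_le.1 (h x y)).1]

theorem tendsto_gromovProd_iff (hD : IsOpen D) (hne : (frontier D).Nonempty)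
    (h : ∀ x y : D, |gromovProd ρ o x y + Real.log (gauge D x y)| ≤ C') {ι : Type*} {l : Filter ι}
    {x y : ι → D} : Tendsto (fun i => gromovProd ρ o (x i) (y i)) l atTop ↔
      Tendsto (fun i => gauge D (x i) (y i)) l (𝓝 0) := by
  constructor
  · intro ht
    refine squeeze_zero (fun i => (gauge_pos hD hne (x i).2 _).le)
      (fun i => gauge_le_exp hD hne h le_rfl) ?_
    exact Real.tendsto_exp_atBot.comp
      (tendsto_atBot_add_const_left l C' (tendsto_neg_atTop_atBot.comp ht))
  · intro ht
    refine tendsto_atTop.2 fun r => ?_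
    filter_upwards [ht.eventually (gt_mem_nhds (Real.exp_pos (-C' - r)))] with i hi
    exact le_gromovProd hD hne h hi.le

theorem gauge_of_mem_frontier {ξ η : Euc d} (hξ : ξ ∈ frontier D) (hη : η ∈ frontier D) :
    gauge D ξ η = ‖ξ - η‖ := by
  have h1 : bdryDist D ξ = 0 := Metric.infDist_zero_of_mem hξ
  have h2 : bdryDist D η = 0 := Metric.infDist_zero_of_mem hη
  simp [gauge, h1, h2]

theorem tendsto_gauge {ι : Type*} {l : Filter ι} {x y : ι → D} {p q : Euc d}
    (hx : Tendsto (fun i => (x i : Euc d)) l (𝓝 p))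
    (hy : Tendsto (fun i => (y i : Euc d)) l (𝓝 q)) :
    Tendsto (fun i => gauge D (x i) (y i)) l (𝓝 (gauge D p q)) := by
  have h := continuous_bdryDist (D := D)
  exact (hx.sub hy).norm.add (((h.tendsto p).comp hx).sqrt.max ((h.tendsto q).comp hy).sqrt)

theorem tendsto_gauge_prod {x y : ℕ → D} {p q : Euc d}
    (hx : Tendsto (fun i => (x i : Euc d)) atTop (𝓝 p))
    (hy : Tendsto (fun i => (y i : Euc d)) atTop (𝓝 q)) :
    Tendsto (fun i : ℕ × ℕ => gauge D (x i.1) (y i.2)) atTop (𝓝 (gauge D p q)) := by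
  rw [← prod_atTop_atTop_eq]
  exact tendsto_gauge (x := fun i : ℕ × ℕ => x i.1) (y := fun i : ℕ × ℕ => y i.2)
    (hx.comp tendsto_fst) (hy.comp tendsto_snd)

/-- The sequences converging at infinity are those that converge to a boundary point. -/
theorem convergesAtInfinity_iff (hD : IsOpen D) (hne : (frontier D).Nonempty)
    (h : ∀ x y : D, |gromovProd ρ o x y + Real.log (gauge D x y)| ≤ C') (x : ℕ → D) :
    ConvergesAtInfinity ρ o x ↔
      ∃ ξ ∈ frontier D, Tendsto (fun i => (x i : Euc d)) atTop (𝓝 ξ) := by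
  rw [ConvergesAtInfinity, tendsto_gromovProd_iff hD hne h (x := fun p : ℕ × ℕ => x p.1)
    (y := fun p : ℕ × ℕ => x p.2)]
  constructor
  · intro ht
    have hcau : CauchySeq fun i => (x i : Euc d) := by
      rw [cauchySeq_iff_tendsto_dist_atTop_0]
      refine squeeze_zero (fun _ => dist_nonneg) (fun p => ?_) ht
      rw [dist_eq_norm]; exact norm_sub_le_gauge _ _
    obtain ⟨ξ, hξ⟩ := cauchySeq_tendsto_of_complete hcau
    refine ⟨ξ, ?_, hξ⟩
    have h0 := tendsto_nhds_unique (tendsto_gauge_prod hξ hξ) ht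
    have h1 : Real.sqrt (bdryDist D ξ) ≤ 0 := h0 ▸ sqrt_bdryDist_le_gauge_left ξ ξ
    have h2 : bdryDist D ξ = 0 :=
      le_antisymm (Real.sqrt_eq_zero'.1 (le_antisymm h1 (Real.sqrt_nonneg _))) (bdryDist_nonneg _)
    exact (isClosed_frontier.mem_iff_infDist_zero hne).2 h2
  · rintro ⟨ξ, hξ, ht⟩
    have := tendsto_gauge_prod ht ht
    rwa [gauge_of_mem_frontier hξ hξ, sub_self, norm_zero] at this

/-- The limit in the Euclidean boundary of a sequence converging at infinity. -/
noncomputable def limitPoint (x : SeqAtInfinity ρ o) : Euc d :=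
  limUnder atTop fun i => (x.1 i : Euc d)

theorem tendsto_limitPoint (hD : IsOpen D) (hne : (frontier D).Nonempty)
    (h : ∀ x y : D, |gromovProd ρ o x y + Real.log (gauge D x y)| ≤ C') (x : SeqAtInfinity ρ o) :
    limitPoint x ∈ frontier D ∧ Tendsto (fun i => (x.1 i : Euc d)) atTop (𝓝 (limitPoint x)) := by
  obtain ⟨ξ, hξ, ht⟩ := (convergesAtInfinity_iff hD hne h x.1).1 x.2
  rw [limitPoint, ht.limUnder_eq]
  exact ⟨hξ, ht⟩

theorem seqEquiv_iff (hD : IsOpen D) (hne : (frontier D).Nonempty)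
    (h : ∀ x y : D, |gromovProd ρ o x y + Real.log (gauge D x y)| ≤ C') (x y : SeqAtInfinity ρ o) :
    SeqEquiv ρ o x y ↔ limitPoint x = limitPoint y := by
  obtain ⟨hx, hx'⟩ := tendsto_limitPoint hD hne h x
  obtain ⟨hy, hy'⟩ := tendsto_limitPoint hD hne h y
  have ht := tendsto_gauge hx' hy'
  rw [gauge_of_mem_frontier hx hy] at ht
  rw [SeqEquiv, tendsto_gromovProd_iff hD hne h]
  constructor
  · intro h0
    exact sub_eq_zero.1 (norm_eq_zero.1 (tendsto_nhds_unique ht h0))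
  · intro e
    rwa [e, sub_self, norm_zero] at ht

/-- The map from the Gromov compactification to Euclidean space that extends the inclusion of `D`
and sends a class of sequences to their common limit. -/
noncomputable def toEuclidean (hD : IsOpen D) (hne : (frontier D).Nonempty)
    (h : ∀ x y : D, |gromovProd ρ o x y + Real.log (gauge D x y)| ≤ C') :
    GromovCompactification ρ o → Euc d
  | .interior x => x
  | .boundary ξ => Quot.lift limitPoint (fun x y => (seqEquiv_iff hD hne h x y).1) ξ

variable (hD : IsOpen D) (hne : (frontier D).Nonempty)
  (h : ∀ x y : D, |gromovProd ρ o x y + Real.log (gauge D x y)| ≤ C')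

theorem toEuclidean_boundary_mem (ξ : GromovBoundary ρ o) :
    toEuclidean hD hne h (.boundary ξ) ∈ frontier D := by
  induction ξ using Quot.ind with
  | mk x => exact (tendsto_limitPoint hD hne h x).1

theorem toEuclidean_mem (a : GromovCompactification ρ o) : toEuclidean hD hne h a ∈ closure D := by
  cases a with
  | interior x => exact subset_closure x.2
  | boundary ξ => exact frontier_subset_closure (toEuclidean_boundary_mem hD hne h ξ)

theorem Represents.tendsto {x : ℕ → D} {a : GromovCompactification ρ o} (hx : Represents x a) :
    Tendsto (fun i => (x i : Euc d)) atTop (𝓝 (toEuclidean hD hne h a)) := by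
  cases a with
  | interior p =>
    have hx : ∀ i, x i = p := hx
    simp only [hx]
    exact tendsto_const_nhds
  | boundary ξ =>
    obtain ⟨hc, rfl⟩ := hx
    exact (tendsto_limitPoint hD hne h ⟨x, hc⟩).2

theorem exists_represents (a : GromovCompactification ρ o) : ∃ x : ℕ → D, Represents x a := by
  cases a with
  | interior p => exact ⟨fun _ => p, fun _ => rfl⟩
  | boundary ξ =>
    obtain ⟨x, rfl⟩ := Quot.exists_rep ξ
    exact ⟨x.1, x.2, rfl⟩

theorem gauge_le_of_lt_extGromovProd {a b : GromovCompactification ρ o} {r : ℝ}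
    (hr : (r : EReal) < extGromovProd a b) :
    gauge D (toEuclidean hD hne h a) (toEuclidean hD hne h b) ≤ Real.exp (C' - r) := by
  obtain ⟨_, ⟨x, y, hx, hy, rfl⟩, hlt⟩ := lt_sSup_iff.1 hr
  refine le_of_tendsto (tendsto_gauge_prod (hx.tendsto hD hne h) (hy.tendsto hD hne h)) ?_
  filter_upwards [eventually_lt_of_lt_liminf hlt] with p hp
  exact gauge_le_exp hD hne h (EReal.coe_lt_coe_iff.1 hp).le

theorem lt_extGromovProd_of_gauge_lt {a b : GromovCompactification ρ o} {r : ℝ}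
    (hr : gauge D (toEuclidean hD hne h a) (toEuclidean hD hne h b) < Real.exp (-C' - (r + 1))) :
    (r : EReal) < extGromovProd a b := by
  obtain ⟨x, hx⟩ := exists_represents a
  obtain ⟨y, hy⟩ := exists_represents b
  have ht := tendsto_gauge_prod (hx.tendsto hD hne h) (hy.tendsto hD hne h)
  have hle : ((r + 1 : ℝ) : EReal) ≤
      liminf (fun p : ℕ × ℕ => ((gromovProd ρ o (x p.1) (y p.2) : ℝ) : EReal)) atTop := by
    refine le_liminf_of_le (by isBoundedDefault) ?_
    filter_upwards [ht.eventually (gt_mem_nhds hr)] with p hp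
    exact EReal.coe_le_coe_iff.2 (le_gromovProd hD hne h hp.le)
  exact (EReal.coe_lt_coe_iff.2 (lt_add_one r)).trans_le (hle.trans (le_sSup ⟨x, y, hx, hy, rfl⟩))

theorem toEuclidean_injective : Function.Injective (toEuclidean hD hne h) := by
  have hdisj : ∀ (x : D) (ξ : GromovBoundary ρ o),
      (x : Euc d) ≠ toEuclidean hD hne h (.boundary ξ) := fun x ξ e => by
    have h1 := toEuclidean_boundary_mem hD hne h ξ
    rw [← e, hD.frontier_eq] at h1
    exact h1.2 x.2
  intro a b hab
  cases a with
  | interior x =>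
    cases b with
    | interior y => exact congrArg _ (Subtype.ext hab)
    | boundary η => exact (hdisj x η hab).elim
  | boundary ξ =>
    cases b with
    | interior y => exact (hdisj y ξ hab.symm).elim
    | boundary η =>
      obtain ⟨x, rfl⟩ := Quot.exists_rep ξ
      obtain ⟨y, rfl⟩ := Quot.exists_rep η
      exact congrArg _ (Quot.sound ((seqEquiv_iff hD hne h x y).2 hab))

theorem exists_toEuclidean_eq {z : Euc d} (hz : z ∈ closure D) :
    ∃ a : GromovCompactification ρ o, toEuclidean hD hne h a = z := by
  by_cases hzD : z ∈ D
  · exact ⟨.interior ⟨z, hzD⟩, rfl⟩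
  · have hzf : z ∈ frontier D := by rw [hD.frontier_eq]; exact ⟨hz, hzD⟩
    obtain ⟨x, hx, ht⟩ := mem_closure_iff_seq_limit.1 hz
    have hc : ConvergesAtInfinity ρ o fun i => (⟨x i, hx i⟩ : D) :=
      (convergesAtInfinity_iff hD hne h _).2 ⟨z, hzf, ht⟩
    refine ⟨.boundary (Quot.mk _ ⟨_, hc⟩), ?_⟩
    exact tendsto_nhds_unique (tendsto_limitPoint hD hne h ⟨_, hc⟩).2 ht

end Boundary

/-- If `ρ` induces the Euclidean topology on `D` and its Gromov product is `log (1 / gauge)` up to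
a constant, then the Gromov compactification is the Euclidean closure. -/
theorem exists_homeomorph (hD : IsOpen D) (hne : (frontier D).Nonempty) {C' : ℝ}
    (h : ∀ x y : D, |gromovProd ρ o x y + Real.log (gauge D x y)| ≤ C')
    (h₁ : ∀ x : D, ∀ e > 0, ∃ r > 0, ∀ y : D, ‖(y : Euc d) - x‖ < r → ρ x y < e)
    (h₂ : ∀ x : D, ∀ r > 0, ∃ e > 0, ∀ y : D, ρ x y < e → ‖(y : Euc d) - x‖ < r) :
    ∃ Φ : GromovCompactification ρ o ≃ₜ closure D,
      ∀ x : D, (Φ (.interior x) : Euc d) = x := by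
  set φ : GromovCompactification ρ o → closure D :=
    fun a => ⟨toEuclidean hD hne h a, toEuclidean_mem hD hne h a⟩ with hφ
  have hbij : Function.Bijective φ := by
    refine ⟨fun a b hab => toEuclidean_injective hD hne h (congrArg Subtype.val hab), fun z => ?_⟩
    obtain ⟨a, ha⟩ := exists_toEuclidean_eq hD hne h z.2
    exact ⟨a, Subtype.ext ha⟩
  refine ⟨(Equiv.ofBijective φ hbij).toHomeomorph fun s => ?_, fun x => rfl⟩
  constructor
  · rintro ⟨hi, hb⟩
    refine Metric.isOpen_iff.2 fun z hz => ?_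
    obtain ⟨a, rfl⟩ := hbij.2 z
    cases a with
    | interior x =>
      obtain ⟨e, he, hx⟩ := hi x hz
      obtain ⟨r, hr, hr'⟩ := h₁ x e he
      refine ⟨min r (bdryDist D x), lt_min hr (bdryDist_pos hD hne x.2), fun w hw => ?_⟩
      have hw : ‖(w : Euc d) - x‖ < min r (bdryDist D x) := by
        rw [← dist_eq_norm]; exact hw
      have hwD : (w : Euc d) ∈ D := by
        refine ball_subset_of_le_bdryDist hD x.2 le_rfl ?_
        rw [Metric.mem_ball, dist_eq_norm]
        exact hw.trans_le (min_le_right _ _)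
      exact hx ⟨w, hwD⟩ (hr' ⟨w, hwD⟩ (hw.trans_le (min_le_left _ _)))
    | boundary ξ =>
      obtain ⟨r, hr⟩ := hb ξ hz
      have hξ := toEuclidean_boundary_mem hD hne h ξ
      set p := toEuclidean hD hne h (.boundary ξ) with hp
      have hcont : Continuous fun w : closure D => gauge D (w : Euc d) p :=
        continuous_gauge continuous_subtype_val continuous_const
      have h0 : gauge D p p < Real.exp (-C' - (r + 1)) := by
        rw [gauge_of_mem_frontier hξ hξ, sub_self, norm_zero]; exact Real.exp_pos _
      have hev : ∀ᶠ w : closure D in 𝓝 (φ (.boundary ξ)),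
          gauge D (w : Euc d) p < Real.exp (-C' - (r + 1)) :=
        (hcont.tendsto (φ (.boundary ξ))).eventually (gt_mem_nhds h0)
      obtain ⟨e, he, hball⟩ := Metric.eventually_nhds_iff_ball.1 hev
      refine ⟨e, he, fun w hw => ?_⟩
      obtain ⟨a, rfl⟩ := hbij.2 w
      have hlt : gauge D (toEuclidean hD hne h a) (toEuclidean hD hne h (.boundary ξ)) <
          Real.exp (-C' - (r + 1)) := hball (φ a) hw
      exact hr a (lt_extGromovProd_of_gauge_lt hD hne h hlt)
  · intro hs
    refine ⟨fun x hx => ?_, fun ξ hξ => ?_⟩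
    · obtain ⟨r, hr, hball⟩ := Metric.isOpen_iff.1 hs _ hx
      obtain ⟨e, he, he'⟩ := h₂ x r hr
      refine ⟨e, he, fun y hy => hball ?_⟩
      rw [Metric.mem_ball, Subtype.dist_eq, dist_eq_norm]
      exact he' y hy
    · obtain ⟨r, hr, hball⟩ := Metric.isOpen_iff.1 hs _ hξ
      refine ⟨C' - Real.log r + 1, fun a ha => hball ?_⟩
      have h1 := gauge_le_of_lt_extGromovProd hD hne h ha
      rw [Metric.mem_ball, Subtype.dist_eq, dist_eq_norm]
      refine (norm_sub_le_gauge _ _).trans_lt (h1.trans_lt ?_)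
      rw [← Real.lt_log_iff_exp_lt hr]
      linarith

end Gromov

end MinDom

theorem proposition4p3 (d : ℕ) (hd : 3 ≤ d) (D : Set (MinDom.Euc d))
    (hD : MinDom.IsStronglyMinimallyConvex D) :
    (∃ ε : ℝ, 0 < ε ∧ ε < 1 ∧ MinDom.HasUniqueProj D ε) ∧
    ∀ ε : ℝ, 0 < ε → ε < 1 → MinDom.HasUniqueProj D ε →
      (∃ c : ℝ, 0 < c ∧ MinDom.FinslerUSC D ε c) ∧
      ∀ c : ℝ, 0 < c → MinDom.FinslerUSC D ε c →
        MinDom.IsMetric (MinDom.distF D ε c) ∧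
        MinDom.IsGromovHyperbolic (MinDom.distF D ε c) ∧
        ∀ o : D, ∃ Φ : MinDom.GromovCompactification (MinDom.distF D ε c) o ≃ₜ closure D,
          ∀ x : D, (Φ (.interior x) : MinDom.Euc d) = x := by
  have hne := hD.frontier_nonempty (by omega)
  have hpre := hD.isConnected.isPreconnected
  obtain ⟨ν, K, hK, hν⟩ := hD.exists_isNormalField
  refine ⟨⟨1 / (4 * K), by positivity, ?_, ?_⟩, fun ε hε hε1 hu => ⟨⟨1 / 2, by norm_num, ?_⟩, ?_⟩⟩
  · rw [div_lt_one (by positivity)]; linarith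
  · refine hν.hasUniqueProj hD.isOpen hne (by positivity) ?_
    have : 2 * (1 / (4 * K)) * K = 1 / 2 := by field_simp; norm_num
    rw [this]; norm_num
  · exact hν.finslerUSC_half hD.isOpen hne hD.isCompact_frontier hε1.le hu
  intro c hc hF
  obtain ⟨C₁, hC₁⟩ :=
    hν.exists_distF_le hD.isOpen hK hD.isConnected hD.isBounded hne hu hε hc.le hF
  obtain ⟨C₂, hC₂⟩ :=
    hν.exists_modelDist_le hD.isOpen hpre hD.isBounded hne hε hε1.le hc hF
  have hmodel : ∀ x y : D, |MinDom.distF D ε c x y - MinDom.modelDist D x y| ≤ max C₁ C₂ := by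
    intro x y
    rw [abs_le]
    constructor
    · linarith [hC₂ x y, le_max_right C₁ C₂]
    · linarith [hC₁ x y, le_max_left C₁ C₂]
  refine ⟨hν.isMetric_distF hD.isOpen hpre hne hε hε1.le hc hF,
    MinDom.isGromovHyperbolic_of_model hD.isOpen hne hmodel, fun o => ?_⟩
  obtain ⟨C', hC'⟩ :=
    MinDom.exists_abs_gromovProd_add_log_le hD.isOpen hne hD.isBounded hmodel o
  refine MinDom.exists_homeomorph hD.isOpen hne hC'
    (fun x e he => hν.exists_distF_lt hD.isOpen hne hc.le hF x he) fun x r hr => ?_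
  obtain ⟨a, ha, hlow⟩ := hν.exists_log_le_distF hD.isOpen hpre hne hε hε1.le hc hF
  have hpos : 0 < Real.log (1 + a * r) := Real.log_pos (by linarith [mul_pos ha hr])
  refine ⟨2 * Real.log (1 + a * r), by positivity, fun y hy => ?_⟩
  have h1 := hlow x y
  have h2 : Real.log (1 + a * ‖(x : MinDom.Euc d) - y‖) < Real.log (1 + a * r) := by linarith
  rw [Real.log_lt_log_iff (by positivity) (by positivity)] at h2
  rw [norm_sub_rev]
  exact lt_of_mul_lt_mul_left (by linarith) ha.le
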